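/- \textbf{Setting.} Let $A,Q\in\mathbb R^{n\times n}$ with $Q>0$ (symmetric positive definite). For each sensor $i$ in a nonempty finite set of $N$ sensors let $C_i\in\mathbb R^{m_i\times n}$, $0<R_i\in\mathbb R^{m_i\times m_i}$ and $\lambda_i\in(0,1]$. Assume that $(A,[C_1'\ \cdots\ C_N']')$ is observable and that $$\Bigl(1-\min_{i}\lambda_i\Bigr)\rho(A)^2<1,$$ where $\rho$ is the spectral radius. The process is $x_{k+1}=Ax_k+w_k$ $(k\ge 0)$ with observations $y^{(i)}_k=C_ix_k+v^{(i)}_k$, where $x_0$ is square integrable and $w_k$, $v_k^{(i)}$ are zero-mean, square-integrable (for instance Gaussian) white noises with covariances $Q$ and $R_i$, all mutually uncorrelated. \textbf{Local filters.} Let the columns of $V_i\in\mathbb R^{n\times n_i}$ be an orthonormal basis of the observable subspace of $(A,C_i)$, i.e. of the row space of $[C_i'\ A'C_i'\ \cdots\ (A')^{n-1}C_i']'$. Put $A_i=V_i'AV_i$, $\tilde C_i=C_iV_i$, $h_{ij}(X)=A_iXA_j'+V_i'QV_j$, $h_i=h_{ii}$, $\tilde g_i(X)=X-X\tilde C_i'(\tilde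 C_iX\tilde C_i'+R_i)^{-1}\tilde C_iX$. Let $P_i^\ast\ge 0$ be the positive semidefinite solution of $X=h_i(\tilde g_i(X))$, $\bar P_i=\tilde g_i(P_i^\ast)$, and $K_i=P_i^\ast\tilde C_i'(\tilde C_iP_i^\ast\tilde C_i'+R_i)^{-1}$. Sensor $i$ runs the steady-state Kalman filter $$\hat\chi^{s,(i)}_{k+1}=A_i\hat\chi^{s,(i)}_{k}+K_i\bigl(y^{(i)}_{k+1}-\tilde C_iA_i\hat\chi^{s,(i)}_{k}\bigr).$$ The filters are in steady state at time $0$: the errors $\mathcal E^{(i)}_0=V_i'x_0-\hat\chi_0^{s,(i)}$ have mean zero, are square integrable, are uncorrelated with all $w_k$, $k\ge0$, and all $v^{(j)}_k$, $k\ge1$, satisfy $\mathbb E[\mathcal E_0^{(i)}\mathcal E_0^{(i)\prime}]=\bar P_i$, and for $i\ne j$ the matrix $\Gamma_{ij}=\mathbb E[\mathcal E_0^{(i)}\mathcal E_0^{(j)\prime}]$ satisfies $\Gamma_{ij}=(I-K_i\tilde C_i)\,h_{ij}(\Gamma_{ij})\,(I-K_j\tilde C_j)'$. \textbf{Lossy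 channels and fusion.} Sensor $i$ sends $\hat\chi_t^{s,(i)}$ at each time $t$; the arrival indicators $\gamma_t^{(i)}\in\{0,1\}$ are independent over all $i$ and $t$, independent of $x_0$, the initial local estimates and the noises, and $\mathbb P(\gamma^{(i)}_t=1)=\lambda_i$. Let $\tau_k^{(i)}=k-t_k^{(i)}$ be the holding time, with $t^{(i)}_k=\max\{t\le k:\gamma_t^{(i)}=1\}$, and $t_k^{(i)}=0$ if nothing has arrived by time $k$ (until then the remote estimator uses the local estimate of time $0$). The remote estimator forms $$\hat x_k=\sum_{i}W_k^{(i)}V_i\,A_i^{\tau_k^{(i)}}\hat\chi^{s,(i)}_{k-\tau_k^{(i)}},\qquad W^{(i)}_k\in\mathbb R^{n\times n}.$$ Let $P_k=\mathbb E[(x_k-\hat x_k)(x_k-\hat x_k)']$, the expectation being over $x_0$, the initial local estimates and the noises, for the realized arrivals. \textbf{Proposition.} For every $k$ and every realization of the arrivals, the problem $$\min_{W_k^{(1)},\dots,W_k^{(N)}}\operatorname{tr}P_k\quad\text{subject to}\quad\sum_{i}W_k^{(i)}V_iV_i'=I$$ has a solution. For any choice of solutions, let $P_k^\ast$ denote the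 resulting error covariance. Then, with $\mathbb E$ the expectation over the arrivals, the entries of $P_k^\ast$ are integrable for every $k$, and $\lim_{k\to\infty}\operatorname{tr}\mathbb E[P_k^\ast]$ exists and is finite. -/

import Mathlib

open MeasureTheory ProbabilityTheory Filter Topology Matrix

noncomputable section

/-- The observability matrix `[C; C A; …; C A ^ (n - 1)]` of the pair `(A, C)`, the row with index
`(k, a)` being row `a` of `C A ^ k`. -/
def obsMatrix {n : ℕ} {p : Type*} (A : Matrix (Fin n) (Fin n) ℝ) (C : Matrix p (Fin n) ℝ) :
    Matrix (Fin n × p) (Fin n) ℝ :=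
  Matrix.of fun r b => (C * A ^ (r.1 : ℕ)) r.2 b

/-- The pair `(A, C)` is observable: its observability matrix has full column rank. -/
def IsObservablePair {n : ℕ} {p : Type*} (A : Matrix (Fin n) (Fin n) ℝ)
    (C : Matrix p (Fin n) ℝ) : Prop :=
  (obsMatrix A C).rank = n

/-- The columns of `V` form an orthonormal basis of the observable subspace of `(A, C)`, which is
the row space of the observability matrix (the orthogonal complement of the unobservable
subspace). Then `V` is the block `V_o` of a Kalman decomposition of `(A, C)`. -/
structure IsObservableBasis {n d : ℕ} {p : Type*} (A : Matrix (Fin n) (Fin n) ℝ)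
    (C : Matrix p (Fin n) ℝ) (V : Matrix (Fin n) (Fin d) ℝ) : Prop where
  orthonormal : Vᵀ * V = 1
  span_eq : LinearMap.range V.mulVecLin = Submodule.span ℝ (Set.range (obsMatrix A C).row)

/-- The spectral radius of a real square matrix: the largest modulus of a complex eigenvalue. -/
def specRad {n : ℕ} (A : Matrix (Fin n) (Fin n) ℝ) : ℝ :=
  (spectralRadius ℂ (A.map (algebraMap ℝ ℂ))).toReal

/-- The deterministic data: a process `x (k+1) = A x k + w k` in dimension `n`, sensors `i : ι`
with observations `y i k = C i x k + v i k`, noise covariances `Q` and `R i`, and for each sensor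
a matrix `V i` whose columns are to be a basis of its observable subspace. -/
structure FusionSystem (n : ℕ) (ι : Type*) (m d : ι → ℕ) where
  A : Matrix (Fin n) (Fin n) ℝ
  C : (i : ι) → Matrix (Fin (m i)) (Fin n) ℝ
  Q : Matrix (Fin n) (Fin n) ℝ
  R : (i : ι) → Matrix (Fin (m i)) (Fin (m i)) ℝ
  V : (i : ι) → Matrix (Fin n) (Fin (d i)) ℝ

namespace FusionSystem

variable {n : ℕ} {ι : Type*} {m d : ι → ℕ} (S : FusionSystem n ι m d)

/-- All observation matrices stacked on top of each other. -/
def stackedC : Matrix ((i : ι) × Fin (m i)) (Fin n) ℝ :=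
  Matrix.of fun p b => S.C p.1 p.2 b

/-- The system matrix on the observable subspace of sensor `i`. -/
def Ao (i : ι) : Matrix (Fin (d i)) (Fin (d i)) ℝ := (S.V i)ᵀ * S.A * S.V i

/-- The observation matrix on the observable subspace of sensor `i`. -/
def Co (i : ι) : Matrix (Fin (m i)) (Fin (d i)) ℝ := S.C i * S.V i

/-- The (cross-)covariance `V i' Q V j` of the projected process noises. -/
def Qo (i j : ι) : Matrix (Fin (d i)) (Fin (d j)) ℝ := (S.V i)ᵀ * S.Q * S.V j

/-- The prediction map `h_ij (X) = A_i X A_j' + V_i' Q V_j`; the map `h_i` is `h_ii`. -/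
def predict (i j : ι) (X : Matrix (Fin (d i)) (Fin (d j)) ℝ) : Matrix (Fin (d i)) (Fin (d j)) ℝ :=
  S.Ao i * X * (S.Ao j)ᵀ + S.Qo i j

/-- The Kalman gain `X C' (C X C' + R)⁻¹` for the prediction covariance `X`. -/
def gain (i : ι) (X : Matrix (Fin (d i)) (Fin (d i)) ℝ) : Matrix (Fin (d i)) (Fin (m i)) ℝ :=
  X * (S.Co i)ᵀ * (S.Co i * X * (S.Co i)ᵀ + S.R i)⁻¹

/-- The measurement update `X - X C' (C X C' + R)⁻¹ C X` of the error covariance. -/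
def update (i : ι) (X : Matrix (Fin (d i)) (Fin (d i)) ℝ) : Matrix (Fin (d i)) (Fin (d i)) ℝ :=
  X - X * (S.Co i)ᵀ * (S.Co i * X * (S.Co i)ᵀ + S.R i)⁻¹ * S.Co i * X

open Classical in
/-- The steady-state prediction error covariance of the local Kalman filter of sensor `i`: the
positive semidefinite fixed point of the Riccati map (`0` should there be none). -/
def steadyPred (i : ι) : Matrix (Fin (d i)) (Fin (d i)) ℝ :=
  if h : ∃ X : Matrix (Fin (d i)) (Fin (d i)) ℝ,
      X.PosSemidef ∧ S.predict i i (S.update i X) = X then h.choose else 0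

/-- The steady-state estimation error covariance of the local Kalman filter of sensor `i`. -/
def steadyCov (i : ι) : Matrix (Fin (d i)) (Fin (d i)) ℝ := S.update i (S.steadyPred i)

/-- The steady-state Kalman gain of sensor `i`. -/
def steadyGain (i : ι) : Matrix (Fin (d i)) (Fin (m i)) ℝ := S.gain i (S.steadyPred i)

/-- One step of the evolution of the cross-covariance between the estimation errors of two
different local steady-state Kalman filters. -/
def crossUpdate (i j : ι) (X : Matrix (Fin (d i)) (Fin (d j)) ℝ) :
    Matrix (Fin (d i)) (Fin (d j)) ℝ :=
  (1 - S.steadyGain i * S.Co i) * S.predict i j X * (1 - S.steadyGain j * S.Co j)ᵀ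

end FusionSystem

/-- The second-moment matrix `E[X Y']` of two random vectors. -/
def secondMoment {Ω : Type*} [MeasurableSpace Ω] (μ : Measure Ω) {p q : Type*}
    (X : Ω → p → ℝ) (Y : Ω → q → ℝ) : Matrix p q ℝ :=
  Matrix.of fun a b => ∫ ω, X ω a * Y ω b ∂μ

/-- The random vector `X` is square integrable and has mean zero. -/
def IsCentered {Ω : Type*} [MeasurableSpace Ω] (μ : Measure Ω) {p : Type*}
    (X : Ω → p → ℝ) : Prop :=
  ∀ a, MemLp (fun ω => X ω a) 2 μ ∧ ∫ ω, X ω a ∂μ = 0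

/-- The random inputs: process noise `w k`, observation noises `v i k`, the initial state `x0`, and
the local estimates `est0 i` that the sensors hold at time `0`. -/
structure FusionInputs (n : ℕ) (ι : Type*) (m d : ι → ℕ) (Ω : Type*) where
  w : ℕ → Ω → Fin n → ℝ
  v : (i : ι) → ℕ → Ω → Fin (m i) → ℝ
  x0 : Ω → Fin n → ℝ
  est0 : (i : ι) → Ω → Fin (d i) → ℝ

namespace FusionInputs

variable {n : ℕ} {ι : Type*} {m d : ι → ℕ} {Ω : Type*}
  (D : FusionInputs n ι m d Ω) (S : FusionSystem n ι m d)

/-- The state of the process. -/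
def state : ℕ → Ω → Fin n → ℝ
  | 0 => D.x0
  | k + 1 => fun ω => S.A *ᵥ state k ω + D.w k ω

/-- The observation of sensor `i`. -/
def obs (i : ι) (k : ℕ) (ω : Ω) : Fin (m i) → ℝ := S.C i *ᵥ D.state S k ω + D.v i k ω

/-- The estimate of `V i' x k` by the local Kalman filter of sensor `i`, run with the steady-state
gain. -/
def localEst (i : ι) : ℕ → Ω → Fin (d i) → ℝ
  | 0 => D.est0 i
  | k + 1 => fun ω =>
      S.Ao i *ᵥ localEst i k ω +
        S.steadyGain i *ᵥ (D.obs S i (k + 1) ω - S.Co i *ᵥ (S.Ao i *ᵥ localEst i k ω))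

/-- The error of the local Kalman filter of sensor `i` at time `k`. -/
def localErr (i : ι) (k : ℕ) (ω : Ω) : Fin (d i) → ℝ :=
  (S.V i)ᵀ *ᵥ D.state S k ω - D.localEst S i k ω

/-- The remote estimate of `V i' x k` at time `k` if the packet received last from sensor `i` is
the one sent at time `t ≤ k`, so that the holding time is `k - t`. -/
def remoteEst (i : ι) (k t : ℕ) (ω : Ω) : Fin (d i) → ℝ :=
  (S.Ao i) ^ (k - t) *ᵥ D.localEst S i t ω

/-- The error at time `k` of the fused estimate `∑ i, W i V i χ i` with fusion coefficients `W`,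
where `t i` is the sending time of the packet received last from sensor `i`. -/
def fusedErr [Fintype ι] (W : ι → Matrix (Fin n) (Fin n) ℝ) (k : ℕ) (t : ι → ℕ) (ω : Ω) :
    Fin n → ℝ :=
  D.state S k ω - ∑ i, W i *ᵥ (S.V i *ᵥ D.remoteEst S i k (t i) ω)

variable [MeasurableSpace Ω] (μ : Measure Ω)

/-- The error covariance `P_k = E[e_k e_k']` of the fused estimate, for given arrivals. -/
def fusedCov [Fintype ι] (W : ι → Matrix (Fin n) (Fin n) ℝ) (k : ℕ) (t : ι → ℕ) :
    Matrix (Fin n) (Fin n) ℝ :=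
  secondMoment μ (D.fusedErr S W k t) (D.fusedErr S W k t)

/-- `W` solves the unbiased linear fusion problem at time `k`: it minimizes `tr P_k` subject to
`∑ i, W i V i V i' = I`. -/
def IsOptimalFusion [Fintype ι] (k : ℕ) (t : ι → ℕ) (W : ι → Matrix (Fin n) (Fin n) ℝ) : Prop :=
  IsMinOn (fun U => (D.fusedCov S μ U k t).trace)
      {U : ι → Matrix (Fin n) (Fin n) ℝ | ∑ i, U i * S.V i * (S.V i)ᵀ = 1} W ∧
    ∑ i, W i * S.V i * (S.V i)ᵀ = 1

/-- The noises are centered, white and mutually uncorrelated, with covariances `Q` and `R i`. -/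
structure IsWhiteNoise : Prop where
  w_centered : ∀ k, IsCentered μ (D.w k)
  w_cov : ∀ k, secondMoment μ (D.w k) (D.w k) = S.Q
  w_white : ∀ k l, k ≠ l → secondMoment μ (D.w k) (D.w l) = 0
  v_centered : ∀ i k, IsCentered μ (D.v i k)
  v_cov : ∀ i k, secondMoment μ (D.v i k) (D.v i k) = S.R i
  v_white : ∀ i k l, k ≠ l → secondMoment μ (D.v i k) (D.v i l) = 0
  v_uncorrelated : ∀ i j k l, i ≠ j → secondMoment μ (D.v i k) (D.v j l) = 0
  w_v_uncorrelated : ∀ i k l, secondMoment μ (D.w k) (D.v i l) = 0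

/-- The local Kalman filters are in steady state at time `0`: the initial estimation errors are
centered and uncorrelated with the noises that enter later, their covariances are the steady-state
ones, and their cross-covariances are invariant. -/
structure IsSteadyStart : Prop where
  x0_memLp : ∀ a, MemLp (fun ω => D.x0 ω a) 2 μ
  centered : ∀ i, IsCentered μ (D.localErr S i 0)
  cov : ∀ i, secondMoment μ (D.localErr S i 0) (D.localErr S i 0) = S.steadyCov i
  cross : ∀ i j, i ≠ j →
    S.crossUpdate i j (secondMoment μ (D.localErr S i 0) (D.localErr S j 0)) =
      secondMoment μ (D.localErr S i 0) (D.localErr S j 0)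
  w_uncorrelated : ∀ i k, secondMoment μ (D.localErr S i 0) (D.w k) = 0
  v_uncorrelated : ∀ i j k, secondMoment μ (D.localErr S i 0) (D.v j (k + 1)) = 0

end FusionInputs

/-- The packet arrival indicators `γ i t` (`true` for an arrival) are independent over all sensors
and times, and `γ i t` is Bernoulli with parameter `rate i`. -/
structure IsBernoulliArrivals {ι Ω : Type*} [MeasurableSpace Ω] (ν : Measure Ω) (rate : ι → ℝ)
    (γ : ι → ℕ → Ω → Bool) : Prop where
  measurable : ∀ i t, Measurable (γ i t)
  prob : ∀ i t, ν.real {ω | γ i t ω = true} = rate i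
  indep : iIndepFun (fun p : ι × ℕ => γ p.1 p.2) ν

/-- The last arrival time `max {t ≤ k | γ i t = 1}` of each sensor. It is `0` as long as nothing
has arrived: until then the remote estimator works with the estimate of time `0`. -/
def lastArrival {ι Ω : Type*} (γ : ι → ℕ → Ω → Bool) (k : ℕ) (ω : Ω) (i : ι) : ℕ :=
  Nat.findGreatest (fun t => γ i t ω = true) k

end

/-! The observable subspace gives `Vᵢ' A = Aᵢ Vᵢ'`, so each projected state evolves autonomously.
Subject to the constraint `∑ Wᵢ Vᵢ Vᵢ' = I`, the fused error is `∑ Wᵢ Vᵢ eᵢ`, where `eᵢ` is the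
error of the propagated packet of sensor `i`. Because the local filters start in steady state, the
covariances of the `eᵢ` depend on the holding times only (`secondMoment_remoteErr`), and so does the
optimal value: `tr Pₖ* = f(τ)` with `f` independent of `k` (`IsOptimalFusion.trace_eq`).

For fixed arrivals the problem is a finite-dimensional least squares problem in `L²` with linear
constraints. Joint observability makes it feasible, a minimizer exists by orthogonal projection, and
all minimizers have the same residual. Hence `Pₖ*` does not depend on the choice of weights and is a
function of finitely many arrival patterns, which makes it integrable.

For the limit, choose `b > max (ρ(A), 1)` with `(1 - min λ) b² < 1`. Comparison with one fixed
feasible weight gives `|f(τ)| ≤ B ∏ b^(2τᵢ)`. The holding times are independent geometric variables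
truncated at `k`, so their law is dominated by `∏ (1 - λᵢ)^τᵢ`, and the product of both bounds is
summable. Dominated convergence yields the limit `∑ f(τ) ∏ λᵢ (1 - λᵢ)^τᵢ`
(`tendsto_integral_holdingTime`).

Stationarity of the local covariances needs a genuine Riccati fixed point, which
`exists_riccati_fixedPoint` supplies. -/

/-! ### The Riccati equation of the local filters -/

section Riccati

lemma posSemidef_transpose_eq {d : Type*} {X : Matrix d d ℝ} (hX : X.PosSemidef) : Xᵀ = X := by
  simpa [Matrix.IsHermitian, conjTranspose_eq_transpose_of_trivial] using hX.isHermitian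

variable {d m p : Type*} [Fintype d]

lemma posSemidef_congr [Fintype p] {X : Matrix d d ℝ} (hX : X.PosSemidef) (E : Matrix d p ℝ) :
    (Eᵀ * X * E).PosSemidef := by
  simpa [conjTranspose_eq_transpose_of_trivial] using hX.conjTranspose_mul_mul_same E

lemma posSemidef_congr' [Fintype p] {X : Matrix d d ℝ} (hX : X.PosSemidef) (E : Matrix p d ℝ) :
    (E * X * Eᵀ).PosSemidef := by
  simpa [conjTranspose_eq_transpose_of_trivial] using hX.mul_mul_conjTranspose_same E

variable [Fintype m]

lemma posSemidef_innovation {C : Matrix m d ℝ} {R : Matrix m m ℝ} {X : Matrix d d ℝ}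
    (hX : X.PosSemidef) (hR : R.PosDef) : (C * X * Cᵀ + R).PosDef :=
  Matrix.PosDef.posSemidef_add (posSemidef_congr' hX C) hR

variable [DecidableEq m]

/-- The Kalman measurement update of an error covariance. -/
noncomputable def measUpdate (C : Matrix m d ℝ) (R : Matrix m m ℝ) (X : Matrix d d ℝ) :
    Matrix d d ℝ :=
  X - X * Cᵀ * (C * X * Cᵀ + R)⁻¹ * C * X

/-- Completion of the square in the gain `U`. -/
lemma measUpdate_complete_square {C : Matrix m d ℝ} {R : Matrix m m ℝ} {X : Matrix d d ℝ}
    (hX : X.PosSemidef) (hR : R.PosDef) (E : Matrix d p ℝ) (U : Matrix m p ℝ) :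
    (E - Cᵀ * U)ᵀ * X * (E - Cᵀ * U) + Uᵀ * R * U =
      Eᵀ * measUpdate C R X * E +
        (U - (C * X * Cᵀ + R)⁻¹ * (C * X * E))ᵀ * (C * X * Cᵀ + R) *
          (U - (C * X * Cᵀ + R)⁻¹ * (C * X * E)) := by
  have hS := posSemidef_innovation (C := C) hX hR
  have hX' := posSemidef_transpose_eq hX
  have hS' := posSemidef_transpose_eq hS.posSemidef
  have hSu : IsUnit (C * X * Cᵀ + R).det := (Matrix.isUnit_iff_isUnit_det _).1 hS.isUnit
  have hG' : ((C * X * Cᵀ + R)⁻¹)ᵀ = (C * X * Cᵀ + R)⁻¹ := by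
    rw [Matrix.transpose_nonsing_inv, hS']
  have hR' : R = (C * X * Cᵀ + R) - C * X * Cᵀ := by abel
  unfold measUpdate
  set S := C * X * Cᵀ + R with hSdef
  have hcancel : ∀ Z : Matrix m p ℝ, S * (S⁻¹ * Z) = Z := fun Z => by
    rw [← Matrix.mul_assoc, Matrix.mul_nonsing_inv _ hSu, Matrix.one_mul]
  have hcancel' : ∀ Z : Matrix m p ℝ, S⁻¹ * (S * Z) = Z := fun Z => by
    rw [← Matrix.mul_assoc, Matrix.nonsing_inv_mul _ hSu, Matrix.one_mul]
  rw [hR']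
  simp only [Matrix.transpose_sub, Matrix.transpose_mul, Matrix.transpose_transpose, hX', hG',
    Matrix.mul_sub, Matrix.sub_mul, Matrix.mul_assoc, hcancel, hcancel']
  abel

/-- Completion of the square at the optimal gain, where the remainder vanishes. This form shows
positivity and matches the recursion of the filter error. -/
lemma measUpdate_joseph [DecidableEq d] {C : Matrix m d ℝ} {R : Matrix m m ℝ} {X : Matrix d d ℝ}
    (hX : X.PosSemidef) (hR : R.PosDef) :
    measUpdate C R X =
      (1 - X * Cᵀ * (C * X * Cᵀ + R)⁻¹ * C) * X * (1 - X * Cᵀ * (C * X * Cᵀ + R)⁻¹ * C)ᵀ +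
        X * Cᵀ * (C * X * Cᵀ + R)⁻¹ * R * (X * Cᵀ * (C * X * Cᵀ + R)⁻¹)ᵀ := by
  have h := measUpdate_complete_square (C := C) hX hR (1 : Matrix d d ℝ)
    ((C * X * Cᵀ + R)⁻¹ * (C * X * (1 : Matrix d d ℝ)))
  have hX' := posSemidef_transpose_eq hX
  have hS' := posSemidef_transpose_eq (posSemidef_innovation (C := C) hX hR).posSemidef
  have hG' : ((C * X * Cᵀ + R)⁻¹)ᵀ = (C * X * Cᵀ + R)⁻¹ := by
    rw [Matrix.transpose_nonsing_inv, hS']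
  simp only [sub_self, Matrix.mul_zero, add_zero, Matrix.mul_one, Matrix.transpose_one,
    Matrix.one_mul] at h
  rw [← h]
  generalize (C * X * Cᵀ + R)⁻¹ = G at hG' ⊢
  simp only [Matrix.transpose_sub, Matrix.transpose_mul, Matrix.transpose_transpose, hX', hG',
    Matrix.transpose_one, Matrix.mul_assoc]

lemma measUpdate_posSemidef {C : Matrix m d ℝ} {R : Matrix m m ℝ} {X : Matrix d d ℝ}
    (hX : X.PosSemidef) (hR : R.PosDef) : (measUpdate C R X).PosSemidef := by
  classical
  rw [measUpdate_joseph hX hR]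
  exact (posSemidef_congr' hX _).add (posSemidef_congr' hR.posSemidef _)

/-- The remainder of the completed square is positive semidefinite: no gain beats the Kalman gain.
-/
lemma measUpdate_le [Fintype p] {C : Matrix m d ℝ} {R : Matrix m m ℝ} {X : Matrix d d ℝ}
    (hX : X.PosSemidef) (hR : R.PosDef) (E : Matrix d p ℝ) (U : Matrix m p ℝ) :
    ((E - Cᵀ * U)ᵀ * X * (E - Cᵀ * U) + Uᵀ * R * U - Eᵀ * measUpdate C R X * E).PosSemidef := by
  rw [measUpdate_complete_square hX hR, add_sub_cancel_left]
  exact posSemidef_congr (posSemidef_innovation hX hR).posSemidef _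

/-- The gain that is optimal for `Y` is admissible, though suboptimal, for `X`, and with a fixed
gain the cost is monotone in the covariance. -/
lemma measUpdate_mono {C : Matrix m d ℝ} {R : Matrix m m ℝ} {X Y : Matrix d d ℝ}
    (hX : X.PosSemidef) (hY : Y.PosSemidef) (hR : R.PosDef) (hXY : (Y - X).PosSemidef) :
    (measUpdate C R Y - measUpdate C R X).PosSemidef := by
  classical
  set U := (C * Y * Cᵀ + R)⁻¹ * (C * Y * (1 : Matrix d d ℝ)) with hU
  have h1 := measUpdate_le (C := C) hX hR (1 : Matrix d d ℝ) U
  have h2 := measUpdate_complete_square (C := C) hY hR (1 : Matrix d d ℝ) U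
  rw [hU, sub_self, Matrix.mul_zero, add_zero, ← hU] at h2
  simp only [Matrix.transpose_one, Matrix.one_mul, Matrix.mul_one] at h1 h2
  have h3 := posSemidef_congr hXY (1 - Cᵀ * U)
  have := h1.add h3
  rw [← h2]
  convert this using 1
  simp only [Matrix.mul_sub, Matrix.sub_mul]
  abel

/-- Testing the quadratic form on `e_a ± e_b` gives `2 |D a b| ≤ D a a + D b b`. -/
lemma posSemidef_abs_entry_le_trace {D : Matrix d d ℝ} (hD : D.PosSemidef) (a b : d) :
    |D a b| ≤ D.trace := by
  classical
  have hsymm : D b a = D a b := by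
    conv_lhs => rw [← posSemidef_transpose_eq hD]
    rfl
  have hdiag : ∀ c, D c c ≤ D.trace := fun c =>
    Finset.single_le_sum (f := fun c => D c c) (fun c _ => hD.diag_nonneg) (Finset.mem_univ c)
  have hq : ∀ s : ℝ, 0 ≤ D a a + s * D a b + s * D b a + s * s * D b b := by
    intro s
    have := hD.dotProduct_mulVec_nonneg (Pi.single a 1 + Pi.single b s)
    simp only [star_trivial, Matrix.mulVec_add, dotProduct_add, add_dotProduct,
      single_dotProduct, Matrix.mulVec_single, Pi.smul_apply, Matrix.col_apply,
      MulOpposite.op_one, one_smul, one_mul, MulOpposite.smul_eq_mul_unop,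
      MulOpposite.unop_op] at this
    linarith
  have h1 := hq 1
  have h2 := hq (-1)
  have ha := hdiag a
  have hb := hdiag b
  rw [abs_le]
  constructor <;> linarith

lemma posSemidef_of_tendsto {D : ℕ → Matrix d d ℝ} {L : Matrix d d ℝ}
    (hD : ∀ k, (D k).PosSemidef) (hL : Tendsto D atTop (𝓝 L)) : L.PosSemidef := by
  refine PosSemidef.of_dotProduct_mulVec_nonneg ?_ fun x => ?_
  · refine tendsto_nhds_unique ((continuous_id.matrix_conjTranspose.tendsto L).comp hL) ?_
    refine hL.congr fun k => ((hD k).isHermitian).symm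
  · refine ge_of_tendsto' (((continuous_const.dotProduct
      (continuous_id.matrix_mulVec continuous_const)).tendsto L).comp hL)
      fun k => (hD k).dotProduct_mulVec_nonneg x

/-- A bounded increasing sequence of symmetric matrices converges. -/
lemma exists_tendsto_of_monotone_of_trace_le {X : ℕ → Matrix d d ℝ}
    (hmono : ∀ k, (X (k + 1) - X k).PosSemidef) {B : ℝ} (hB : ∀ k, (X k).trace ≤ B) :
    ∃ L, Tendsto X atTop (𝓝 L) := by
  have hmono' : ∀ k l, k ≤ l → (X l - X k).PosSemidef := by
    intro k l hkl
    induction l, hkl using Nat.le_induction with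
    | base => rw [sub_self]; exact PosSemidef.zero
    | succ l _ ih => simpa using (hmono l).add ih
  have htr : ∀ k l, k ≤ l → (X l).trace - (X k).trace = (X l - X k).trace := fun k l _ => by
    rw [Matrix.trace_sub]
  have hmt : Monotone fun k => (X k).trace := by
    intro k l hkl
    have := (hmono' k l hkl).trace_nonneg
    rw [← htr k l hkl] at this
    simpa using this
  have hconv : CauchySeq fun k => (X k).trace :=
    (tendsto_atTop_ciSup hmt ⟨B, by rintro _ ⟨k, rfl⟩; exact hB k⟩).cauchySeq
  -- Increments are positive semidefinite, so the Cauchy property of the traces passes to every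
  -- entry.
  have hentry : ∀ a b, ∃ c, Tendsto (fun k => X k a b) atTop (𝓝 c) := by
    intro a b
    apply cauchySeq_tendsto_of_complete
    rw [Metric.cauchySeq_iff'] at hconv ⊢
    intro ε hε
    obtain ⟨N, hN⟩ := hconv ε hε
    refine ⟨N, fun k hk => lt_of_le_of_lt ?_ (hN k hk)⟩
    rw [Real.dist_eq, Real.dist_eq, htr N k hk]
    exact (posSemidef_abs_entry_le_trace (hmono' N k hk) a b).trans (le_abs_self _)
  choose c hc using hentry
  exact ⟨Matrix.of c, tendsto_pi_nhds.2 fun a => tendsto_pi_nhds.2 fun b => hc a b⟩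

lemma measUpdate_tendsto {C : Matrix m d ℝ} {R : Matrix m m ℝ} {X : ℕ → Matrix d d ℝ}
    {L : Matrix d d ℝ} (hR : R.PosDef) (hL : L.PosSemidef) (hX : Tendsto X atTop (𝓝 L)) :
    Tendsto (fun k => measUpdate C R (X k)) atTop (𝓝 (measUpdate C R L)) := by
  have hS : Tendsto (fun k => C * X k * Cᵀ + R) atTop (𝓝 (C * L * Cᵀ + R)) :=
    ((by fun_prop : Continuous fun X : Matrix d d ℝ => C * X * Cᵀ + R).tendsto L).comp hX
  have hdet : (C * L * Cᵀ + R).det ≠ 0 :=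
    ((Matrix.isUnit_iff_isUnit_det _).1 (posSemidef_innovation (C := C) hL hR).isUnit).ne_zero
  have hinv : ContinuousAt Inv.inv (C * L * Cᵀ + R) := by
    refine continuousAt_matrix_inv _ ?_
    rw [Ring.inverse_eq_inv']
    exact continuousAt_inv₀ hdet
  have hG := hinv.tendsto.comp hS
  have hcont : Continuous fun Z : Matrix d d ℝ × Matrix m m ℝ =>
      Z.1 - Z.1 * Cᵀ * Z.2 * C * Z.1 := by fun_prop
  exact (hcont.tendsto (L, (C * L * Cᵀ + R)⁻¹)).comp (hX.prodMk_nhds hG)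

/-- The Riccati map of an observable pair `(F, C)` has a positive semidefinite fixed point. -/
theorem exists_riccati_fixedPoint [DecidableEq d] {F : Matrix d d ℝ} {C : Matrix m d ℝ}
    {Q : Matrix d d ℝ} {R : Matrix m m ℝ} (hQ : Q.PosSemidef) (hR : R.PosDef) (N : ℕ)
    (M : ℕ → Matrix m d ℝ) (hM : ∑ k ∈ Finset.range N, (Fᵀ) ^ k * Cᵀ * M k = 1) :
    ∃ X : Matrix d d ℝ, X.PosSemidef ∧ F * measUpdate C R X * Fᵀ + Q = X := by
  set ric : Matrix d d ℝ → Matrix d d ℝ := fun X => F * measUpdate C R X * Fᵀ + Q with hric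
  -- Starting the iteration at `0` makes its first step increasing; monotonicity of the Riccati map
  -- propagates this.
  set X : ℕ → Matrix d d ℝ := fun k => ric^[k] 0 with hXdef
  have hsucc : ∀ k, X (k + 1) = F * measUpdate C R (X k) * Fᵀ + Q := fun k => by
    simp only [hXdef, Function.iterate_succ_apply', hric]
  have hpos : ∀ k, (X k).PosSemidef := by
    intro k
    induction k with
    | zero => exact PosSemidef.zero
    | succ k ih =>
      rw [hsucc]
      exact (posSemidef_congr' (measUpdate_posSemidef ih hR) F).add hQ
  have hmono : ∀ k, (X (k + 1) - X k).PosSemidef := by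
    intro k
    induction k with
    | zero => simpa [hXdef] using hpos 1
    | succ k ih =>
      have := posSemidef_congr' (measUpdate_mono (C := C) (hpos k) (hpos (k + 1)) hR ih) F
      rw [Matrix.mul_sub, Matrix.sub_mul, ← add_sub_add_right_eq_sub _ _ Q, ← hsucc, ← hsucc]
        at this
      exact this
  -- an input sequence that steers the dual system from `1` to `0` in `N` steps
  set U : ℕ → Matrix m d ℝ := fun t => if t < N then M (N - 1 - t) * (Fᵀ) ^ N else 0 with hU
  set Ξ : ℕ → Matrix d d ℝ := fun t =>
    Nat.rec 1 (fun s Z => Fᵀ * Z - Cᵀ * U s) t with hΞ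
  have hΞs : ∀ t, Ξ (t + 1) = Fᵀ * Ξ t - Cᵀ * U t := fun t => rfl
  have hΞclosed : ∀ t, t ≤ N → Ξ t =
      (Fᵀ) ^ t - ∑ s ∈ Finset.range t, (Fᵀ) ^ (t - 1 - s) * Cᵀ * U s := by
    intro t
    induction t with
    | zero => intro _; simp [hΞ]
    | succ t ih =>
      intro ht
      rw [hΞs, ih (by omega), Finset.sum_range_succ, Matrix.mul_sub, Finset.mul_sum, pow_succ',
        ← sub_sub]
      congr 1
      · congr 1
        refine Finset.sum_congr rfl fun s hs => ?_
        have hs' := Finset.mem_range.1 hs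
        rw [show t + 1 - 1 - s = (t - 1 - s) + 1 by omega, pow_succ']
        simp only [Matrix.mul_assoc]
      · simp
  have hΞN : Ξ N = 0 := by
    rw [hΞclosed N le_rfl, sub_eq_zero]
    calc (Fᵀ) ^ N = (∑ k ∈ Finset.range N, (Fᵀ) ^ k * Cᵀ * M k) * (Fᵀ) ^ N := by
          rw [hM, Matrix.one_mul]
      _ = (∑ k ∈ Finset.range N, (Fᵀ) ^ (N - 1 - k) * Cᵀ * M (N - 1 - k)) * (Fᵀ) ^ N := by
          rw [Finset.sum_range_reflect (fun k => (Fᵀ) ^ k * Cᵀ * M k) N]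
      _ = _ := by
          rw [Finset.sum_mul]
          refine Finset.sum_congr rfl fun s hs => ?_
          have hs' := Finset.mem_range.1 hs
          simp only [hU, hs', if_true, Matrix.mul_assoc]
  have hΞ0 : ∀ t, N ≤ t → Ξ t = 0 := by
    intro t ht
    induction t, ht using Nat.le_induction with
    | base => exact hΞN
    | succ t ht ih => rw [hΞs, ih]; simp [hU, Nat.not_lt.2 ht]
  -- The stage cost of the dual regulator problem along the steered trajectory; it vanishes from
  -- time `N` on.
  set c : ℕ → ℝ := fun t => ((Ξ t)ᵀ * Q * Ξ t).trace + ((U t)ᵀ * R * U t).trace with hc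
  have hc0 : ∀ t, 0 ≤ c t := fun t => add_nonneg (posSemidef_congr hQ _).trace_nonneg
    (posSemidef_congr hR.posSemidef _).trace_nonneg
  have hcN : ∀ t, N ≤ t → c t = 0 := fun t ht => by
    simp [hc, hΞ0 t ht, hU, Nat.not_lt.2 ht]
  -- `X k` is the optimal `k`-step cost matrix of the dual regulator, so the input `U` can only cost
  -- more. At `s = 0`, where `Ξ` is the identity, this bounds the trace of `X k` uniformly in `k`.
  have hcost : ∀ k s, ((Ξ s)ᵀ * X k * Ξ s).trace ≤ ∑ t ∈ Finset.range k, c (s + t) := by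
    intro k
    induction k with
    | zero => intro s; simp [hXdef]
    | succ k ih =>
      intro s
      have h1 := (measUpdate_le (C := C) (hpos k) hR (Fᵀ * Ξ s) (U s)).trace_nonneg
      rw [← hΞs, Matrix.trace_sub, Matrix.trace_add] at h1
      have h2 := ih (s + 1)
      have h3 : (Ξ s)ᵀ * X (k + 1) * Ξ s =
          (Fᵀ * Ξ s)ᵀ * measUpdate C R (X k) * (Fᵀ * Ξ s) + (Ξ s)ᵀ * Q * Ξ s := by
        rw [hsucc]
        simp only [Matrix.mul_add, Matrix.add_mul, Matrix.transpose_mul,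
          Matrix.transpose_transpose, Matrix.mul_assoc]
      rw [Finset.sum_range_succ', h3, Matrix.trace_add]
      have h4 : ∑ t ∈ Finset.range k, c (s + (t + 1)) = ∑ t ∈ Finset.range k, c (s + 1 + t) :=
        Finset.sum_congr rfl fun t _ => by rw [add_right_comm, add_assoc]
      have h5 : c (s + 0) = ((Ξ s)ᵀ * Q * Ξ s).trace + ((U s)ᵀ * R * U s).trace := rfl
      rw [h4, h5]
      linarith
  have hbound : ∀ k, (X k).trace ≤ ∑ t ∈ Finset.range N, c t := by
    intro k
    have h := hcost k 0
    have h0 : Ξ 0 = 1 := rfl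
    simp only [h0, Matrix.transpose_one, Matrix.one_mul, Matrix.mul_one, zero_add] at h
    refine h.trans ?_
    rcases le_total k N with hk | hk
    · exact Finset.sum_le_sum_of_subset_of_nonneg (Finset.range_mono hk) fun t _ _ => hc0 t
    · refine (Finset.sum_subset (Finset.range_mono hk) fun t _ ht => hcN t ?_).ge
      simpa using ht
  obtain ⟨L, hL⟩ := exists_tendsto_of_monotone_of_trace_le hmono hbound
  have hLpos := posSemidef_of_tendsto hpos hL
  refine ⟨L, hLpos, ?_⟩
  have h1 := (tendsto_add_atTop_iff_nat 1).2 hL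
  have h2 : Tendsto (fun k => F * measUpdate C R (X k) * Fᵀ + Q) atTop
      (𝓝 (F * measUpdate C R L * Fᵀ + Q)) :=
    ((by fun_prop : Continuous fun Z : Matrix d d ℝ => F * Z * Fᵀ + Q).tendsto _).comp
      (measUpdate_tendsto hR hLpos hL)
  refine tendsto_nhds_unique h2 ?_
  simpa only [hsucc] using h1

end Riccati

/-! ### The observable subspace and the reduced pair -/

section Observability

variable {n d m : ℕ} {A : Matrix (Fin n) (Fin n) ℝ} {C : Matrix (Fin m) (Fin n) ℝ}
  {V : Matrix (Fin n) (Fin d) ℝ}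

/-- Cayley–Hamilton: reduce `X ^ k` modulo the characteristic polynomial. Dimension `0` is separate
because that polynomial is then `1`. -/
lemma exists_pow_eq_sum_pow_lt (A : Matrix (Fin n) (Fin n) ℝ) (k : ℕ) :
    ∃ c : ℕ → ℝ, A ^ k = ∑ j ∈ Finset.range n, c j • A ^ j := by
  rcases Nat.eq_zero_or_pos n with rfl | hn
  · exact ⟨0, Subsingleton.elim _ _⟩
  · have : Nonempty (Fin n) := ⟨⟨0, hn⟩⟩
    refine ⟨(Polynomial.X ^ k %ₘ A.charpoly).coeff, ?_⟩
    rw [Matrix.pow_eq_aeval_mod_charpoly]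
    refine Polynomial.aeval_eq_sum_range' ?_ A
    have h := Polynomial.natDegree_modByMonic_lt (Polynomial.X ^ k) A.charpoly_monic
      (fun h => by
        have := A.charpoly_natDegree_eq_dim
        rw [h] at this
        simp at this
        omega)
    simpa [A.charpoly_natDegree_eq_dim] using h

namespace IsObservableBasis

lemma exists_eq_sum (h : IsObservableBasis A C V) :
    ∃ M : ℕ → Matrix (Fin m) (Fin d) ℝ, V = ∑ k ∈ Finset.range n, (C * A ^ k)ᵀ * M k := by
  have hcol : ∀ b, ∃ z : Fin n × Fin m → ℝ, (obsMatrix A C)ᵀ *ᵥ z = V.col b := by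
    intro b
    have h1 : V.col b ∈ LinearMap.range V.mulVecLin :=
      ⟨Pi.single b 1, by simp⟩
    rw [h.span_eq] at h1
    have h2 : LinearMap.range (obsMatrix A C)ᵀ.mulVecLin =
        Submodule.span ℝ (Set.range (obsMatrix A C).row) := by
      rw [Matrix.range_mulVecLin]; rfl
    rw [← h2] at h1
    exact h1
  choose z hz using hcol
  refine ⟨fun k => if hk : k < n then Matrix.of fun a b => z b (⟨k, hk⟩, a) else 0, ?_⟩
  ext a b
  rw [Finset.sum_range, Matrix.sum_apply]
  have := congrFun (hz b) a
  rw [Matrix.col_apply] at this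
  rw [← this]
  simp only [Fin.is_lt, dite_true, Fin.eta, Matrix.mulVec, dotProduct, Matrix.mul_apply,
    Matrix.transpose_apply, Matrix.of_apply, obsMatrix, Fintype.sum_prod_type]

/-- `V Vᵀ` is the orthogonal projection onto the row space, which contains the rows of `C A ^ k` for
`k < n` by definition and for all `k` by Cayley–Hamilton. -/
lemma mul_pow_mul_proj (h : IsObservableBasis A C V) (k : ℕ) : C * A ^ k * V * Vᵀ = C * A ^ k := by
  have hlt : ∀ j < n, C * A ^ j * V * Vᵀ = C * A ^ j := by
    intro j hj
    have hproj : ∀ y ∈ LinearMap.range V.mulVecLin, y ᵥ* (V * Vᵀ) = y := by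
      rintro _ ⟨u, rfl⟩
      rw [Matrix.mulVecLin_apply, ← Matrix.mulVec_transpose, Matrix.transpose_mul,
        Matrix.transpose_transpose, Matrix.mulVec_mulVec, Matrix.mul_assoc, h.orthonormal,
        Matrix.mul_one]
    refine Matrix.ext_row fun a => ?_
    have h1 : (C * A ^ j).row a ∈ LinearMap.range V.mulVecLin := by
      rw [h.span_eq]
      exact Submodule.subset_span ⟨(⟨j, hj⟩, a), rfl⟩
    have h2 := hproj _ h1
    rw [Matrix.mul_assoc]
    exact h2
  obtain ⟨c, hc⟩ := exists_pow_eq_sum_pow_lt A k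
  rw [hc]
  simp only [Matrix.mul_sum, Matrix.sum_mul, Matrix.mul_smul, Matrix.smul_mul]
  exact Finset.sum_congr rfl fun j hj => by rw [hlt j (Finset.mem_range.1 hj)]

lemma mul_proj (h : IsObservableBasis A C V) : C * V * Vᵀ = C := by
  simpa using h.mul_pow_mul_proj 0

/-- The row space is invariant under right multiplication by `A`: this only shifts the powers in `C
A ^ k`. Hence the projected state obeys a recursion of its own. -/
lemma transpose_mul_eq (h : IsObservableBasis A C V) : Vᵀ * A = Vᵀ * A * V * Vᵀ := by
  obtain ⟨M, hM⟩ := h.exists_eq_sum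
  have h1 : Vᵀ * A = ∑ k ∈ Finset.range n, (M k)ᵀ * (C * A ^ (k + 1)) := by
    conv_lhs => rw [hM]
    simp only [Matrix.transpose_sum, Matrix.transpose_mul, Matrix.transpose_transpose,
      Matrix.sum_mul, Matrix.mul_assoc, pow_succ]
  rw [h1]
  simp only [Matrix.sum_mul]
  refine Finset.sum_congr rfl fun k _ => ?_
  rw [Matrix.mul_assoc, Matrix.mul_assoc, ← Matrix.mul_assoc _ V, h.mul_pow_mul_proj]

lemma transpose_mul_pow (h : IsObservableBasis A C V) (k : ℕ) : Vᵀ * A ^ k = (Vᵀ * A * V) ^ k * Vᵀ := by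
  induction k with
  | zero => simp
  | succ k ih =>
    rw [pow_succ, ← Matrix.mul_assoc, ih, pow_succ, Matrix.mul_assoc,
      Matrix.mul_assoc _ (Vᵀ * A * V), ← h.transpose_mul_eq]

lemma reduced_pow (h : IsObservableBasis A C V) (k : ℕ) : (Vᵀ * A * V) ^ k = Vᵀ * A ^ k * V := by
  rw [h.transpose_mul_pow, Matrix.mul_assoc _ Vᵀ, h.orthonormal, Matrix.mul_one]

/-- Expanding the second factor of `Vᵀ V = 1` in the rows `C A ^ k` yields the coefficients that
steer the dual system to zero. -/
lemma reduced_observable (h : IsObservableBasis A C V) : ∃ M : ℕ → Matrix (Fin m) (Fin d) ℝ,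
    ∑ k ∈ Finset.range n, ((Vᵀ * A * V)ᵀ) ^ k * (C * V)ᵀ * M k = 1 := by
  obtain ⟨M, hM⟩ := h.exists_eq_sum
  refine ⟨M, ?_⟩
  rw [← h.orthonormal]
  conv_rhs => rw [hM]
  rw [Matrix.mul_sum]
  refine Finset.sum_congr rfl fun k _ => ?_
  rw [← Matrix.transpose_pow, ← Matrix.transpose_mul, h.reduced_pow, ← Matrix.mul_assoc,
    ← Matrix.mul_assoc, h.mul_proj, Matrix.transpose_mul (C * A ^ k), ← hM, Matrix.mul_assoc]

end IsObservableBasis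

end Observability

/-! ### Growth of matrix powers -/

lemma specRad_nonneg {n : ℕ} (A : Matrix (Fin n) (Fin n) ℝ) : 0 ≤ specRad A :=
  ENNReal.toReal_nonneg

/-- Powers of a matrix grow at most like powers of any number above the spectral radius. -/
lemma exists_abs_pow_entry_le {n : ℕ} (A : Matrix (Fin n) (Fin n) ℝ) {b : ℝ} (hb : specRad A < b) :
    ∃ c : ℝ, 0 ≤ c ∧ ∀ (s : ℕ) (i j : Fin n), |(A ^ s) i j| ≤ c * b ^ s := by
  let : NormedRing (Matrix (Fin n) (Fin n) ℂ) := Matrix.linftyOpNormedRing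
  let : NormedAlgebra ℂ (Matrix (Fin n) (Fin n) ℂ) := Matrix.linftyOpNormedAlgebra
  have : CompleteSpace (Matrix (Fin n) (Fin n) ℂ) := FiniteDimensional.complete ℂ _
  have hb0 : 0 < b := (specRad_nonneg A).trans_lt hb
  set Z : Matrix (Fin n) (Fin n) ℂ := A.map (algebraMap ℝ ℂ) with hZ
  have hentry : ∀ (s : ℕ) (i j : Fin n), |(A ^ s) i j| ≤ ‖Z ^ s‖ := by
    intro s i j
    have h1 : Z ^ s = (A ^ s).map (algebraMap ℝ ℂ) := by
      rw [hZ]; exact (Matrix.map_pow A (algebraMap ℝ ℂ) s).symm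
    have h2 : |(A ^ s) i j| = ‖(Z ^ s) i j‖ := by
      rw [h1, Matrix.map_apply]; simp
    rw [h2, Matrix.linfty_opNorm_def]
    have h3 : ‖(Z ^ s) i j‖₊ ≤ Finset.univ.sup fun i => ∑ j, ‖(Z ^ s) i j‖₊ :=
      (Finset.single_le_sum (f := fun j => ‖(Z ^ s) i j‖₊) (fun _ _ => zero_le)
        (Finset.mem_univ j)).trans
        (Finset.le_sup (f := fun i => ∑ j, ‖(Z ^ s) i j‖₊) (Finset.mem_univ i))
    exact_mod_cast h3
  -- Finiteness ensures that `toReal` in `specRad` loses nothing.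
  have hfin : spectralRadius ℂ Z ≠ ⊤ := by
    rcases Nat.eq_zero_or_pos n with rfl | hn
    · simp
    · have : Nonempty (Fin n) := ⟨⟨0, hn⟩⟩
      have : NormOneClass (Matrix (Fin n) (Fin n) ℂ) := Matrix.linfty_opNormOneClass
      exact ne_top_of_le_ne_top ENNReal.coe_ne_top (spectrum.spectralRadius_le_nnnorm Z)
  have hlt : spectralRadius ℂ Z < ENNReal.ofReal b := by
    rw [← ENNReal.ofReal_toReal hfin]
    exact (ENNReal.ofReal_lt_ofReal_iff hb0).2 hb
  -- Gelfand's formula bounds all large powers; exponents from `N + 1` on avoid the meaningless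
  -- zeroth root.
  obtain ⟨N, hN⟩ := eventually_atTop.1
    ((spectrum.pow_norm_pow_one_div_tendsto_nhds_spectralRadius Z).eventually_lt_const hlt)
  have hlarge : ∀ s, N + 1 ≤ s → ‖Z ^ s‖ ≤ b ^ s := by
    intro s hs
    have h1 := (ENNReal.ofReal_lt_ofReal_iff hb0).1 (hN s (by omega))
    have h2 : (‖Z ^ s‖ ^ (1 / s : ℝ)) ^ s ≤ b ^ s :=
      pow_le_pow_left₀ (Real.rpow_nonneg (norm_nonneg _) _) h1.le s
    rwa [one_div, Real.rpow_inv_natCast_pow (norm_nonneg _) (by omega)] at h2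
  -- The `1` serves the tail and the sum the finitely many early powers.
  refine ⟨1 + ∑ s ∈ Finset.range (N + 1), ‖Z ^ s‖ / b ^ s, ?_, fun s i j => (hentry s i j).trans ?_⟩
  · positivity
  · have hsum0 : 0 ≤ ∑ s ∈ Finset.range (N + 1), ‖Z ^ s‖ / b ^ s := by positivity
    rcases Nat.lt_or_ge s (N + 1) with hs | hs
    · have h1 : ‖Z ^ s‖ / b ^ s ≤ ∑ s ∈ Finset.range (N + 1), ‖Z ^ s‖ / b ^ s :=
        Finset.single_le_sum (f := fun s => ‖Z ^ s‖ / b ^ s) (fun _ _ => by positivity)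
          (Finset.mem_range.2 hs)
      rw [← div_le_iff₀ (by positivity)]
      linarith
    · have := hlarge s hs
      nlinarith [mul_nonneg hsum0 (pow_pos hb0 s).le]

/-! ### Feasible weights and steady-state covariances -/

namespace FusionSystem

variable {n : ℕ} {ι : Type*} {m d : ι → ℕ} (S : FusionSystem n ι m d)

/-- The common weight is the inverse of `∑ Vᵢ Vᵢ'`: a vector killed by this sum is orthogonal to
every observable subspace, hence unobservable for the stacked pair. It depends on neither time nor
arrivals, which later makes the bound uniform. -/
lemma exists_feasible [Fintype ι] (hV : ∀ i, IsObservableBasis S.A (S.C i) (S.V i))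
    (hobs : IsObservablePair S.A S.stackedC) :
    ∃ W : Matrix (Fin n) (Fin n) ℝ, ∑ i, W * S.V i * (S.V i)ᵀ = 1 := by
  set T := ∑ i, S.V i * (S.V i)ᵀ with hT
  suffices hu : IsUnit T.det by
    refine ⟨T⁻¹, ?_⟩
    simp only [Matrix.mul_assoc]
    rw [← Matrix.mul_sum, ← hT, Matrix.nonsing_inv_mul _ hu]
  rw [← Matrix.isUnit_iff_isUnit_det, ← Matrix.mulVec_injective_iff_isUnit]
  have hinj : Function.Injective (obsMatrix S.A S.stackedC).mulVec := by
    rw [Matrix.mulVec_injective_iff, linearIndependent_iff_card_eq_finrank_span]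
    rw [IsObservablePair, Matrix.rank_eq_finrank_span_cols] at hobs
    simpa [Set.finrank] using hobs.symm
  have hker : ∀ x, T *ᵥ x = 0 → x = 0 := by
    intro x hx
    have h1 : ∑ i, ((S.V i)ᵀ *ᵥ x) ⬝ᵥ ((S.V i)ᵀ *ᵥ x) = 0 := by
      have h2 : x ⬝ᵥ T *ᵥ x = 0 := by rw [hx, dotProduct_zero]
      rw [hT, Matrix.sum_mulVec, dotProduct_sum] at h2
      rw [← h2]
      refine Finset.sum_congr rfl fun i _ => ?_
      rw [← Matrix.mulVec_mulVec, Matrix.dotProduct_mulVec x, ← Matrix.mulVec_transpose]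
    have h3 : ∀ i, (S.V i)ᵀ *ᵥ x = 0 := fun i => by
      have := (Finset.sum_eq_zero_iff_of_nonneg fun i _ =>
        (Finset.sum_nonneg fun a _ => mul_self_nonneg _ :
          0 ≤ ((S.V i)ᵀ *ᵥ x) ⬝ᵥ ((S.V i)ᵀ *ᵥ x))).1 h1 i (Finset.mem_univ i)
      exact dotProduct_self_eq_zero.1 this
    refine hinj ?_
    rw [Matrix.mulVec_zero]
    ext ⟨k, i, a⟩
    have h4 : (S.C i * S.A ^ (k : ℕ)) *ᵥ x = 0 := by
      rw [← (hV i).mul_pow_mul_proj, ← Matrix.mulVec_mulVec, h3, Matrix.mulVec_zero]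
    exact congrFun h4 a
  intro x y hxy
  exact sub_eq_zero.1 (hker _ (by rw [Matrix.mulVec_sub]; exact sub_eq_zero.2 hxy))

/-- The default `0` in `steadyPred` is never taken. Any positive semidefinite fixed point serves the
argument, so uniqueness is not needed. -/
lemma steadyPred_spec (i : ι) (hQ : S.Q.PosDef) (hR : (S.R i).PosDef)
    (hV : IsObservableBasis S.A (S.C i) (S.V i)) :
    (S.steadyPred i).PosSemidef ∧ S.predict i i (S.steadyCov i) = S.steadyPred i := by
  obtain ⟨M, hM⟩ := hV.reduced_observable
  have hex : ∃ X : Matrix (Fin (d i)) (Fin (d i)) ℝ,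
      X.PosSemidef ∧ S.predict i i (S.update i X) = X :=
    exists_riccati_fixedPoint (F := S.Ao i) (C := S.Co i) (Q := S.Qo i i) (R := S.R i)
      (posSemidef_congr hQ.posSemidef (S.V i)) hR n M hM
  rw [steadyCov, steadyPred, dif_pos hex]
  exact hex.choose_spec

/-- The Joseph form of the steady-state covariance equation. -/
lemma steadyCov_joseph (i : ι) (hQ : S.Q.PosDef) (hR : (S.R i).PosDef)
    (hV : IsObservableBasis S.A (S.C i) (S.V i)) :
    (1 - S.steadyGain i * S.Co i) * S.predict i i (S.steadyCov i) *
        (1 - S.steadyGain i * S.Co i)ᵀ + S.steadyGain i * S.R i * (S.steadyGain i)ᵀ =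
      S.steadyCov i := by
  obtain ⟨h1, h2⟩ := S.steadyPred_spec i hQ hR hV
  rw [h2]
  exact (measUpdate_joseph (C := S.Co i) h1 hR).symm

end FusionSystem

/-! ### Calculus of second moments -/

section SecondMoment

variable {Ω : Type*} [MeasurableSpace Ω] {μ : Measure Ω} {p q r : Type*}

/-- All coordinates of the random vector `X` are square integrable. -/
def IsSquareIntegrable (μ : Measure Ω) (X : Ω → p → ℝ) : Prop :=
  ∀ a, MemLp (fun ω => X ω a) 2 μ

lemma IsCentered.isSquareIntegrable {X : Ω → p → ℝ} (hX : IsCentered μ X) :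
    IsSquareIntegrable μ X := fun a => (hX a).1

namespace IsSquareIntegrable

variable {X X' : Ω → p → ℝ} {Y : Ω → q → ℝ}

lemma add (hX : IsSquareIntegrable μ X) (hX' : IsSquareIntegrable μ X') :
    IsSquareIntegrable μ fun ω => X ω + X' ω := fun a => (hX a).add (hX' a)

lemma sub (hX : IsSquareIntegrable μ X) (hX' : IsSquareIntegrable μ X') :
    IsSquareIntegrable μ fun ω => X ω - X' ω := fun a => (hX a).sub (hX' a)

lemma mulVec [Fintype p] (hX : IsSquareIntegrable μ X) (M : Matrix q p ℝ) :
    IsSquareIntegrable μ fun ω => M *ᵥ X ω := fun a => by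
  simp only [Matrix.mulVec, dotProduct]
  exact memLp_finsetSum _ fun b _ => (hX b).const_mul _

lemma integrable_mul (hX : IsSquareIntegrable μ X) (hY : IsSquareIntegrable μ Y) (a : p) (b : q) :
    Integrable (fun ω => X ω a * Y ω b) μ :=
  (hX a).integrable_mul (hY b)

end IsSquareIntegrable

variable {X X' : Ω → p → ℝ} {Y Y' : Ω → q → ℝ}

lemma secondMoment_transpose (X : Ω → p → ℝ) (Y : Ω → q → ℝ) :
    (secondMoment μ X Y)ᵀ = secondMoment μ Y X := by
  ext a b
  simp only [secondMoment, Matrix.transpose_apply, Matrix.of_apply, mul_comm]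

lemma secondMoment_add_left (hX : IsSquareIntegrable μ X) (hX' : IsSquareIntegrable μ X')
    (hY : IsSquareIntegrable μ Y) :
    secondMoment μ (fun ω => X ω + X' ω) Y = secondMoment μ X Y + secondMoment μ X' Y := by
  ext a b
  simp only [secondMoment, Matrix.of_apply, Matrix.add_apply, Pi.add_apply, add_mul]
  exact integral_add (hX.integrable_mul hY a b) (hX'.integrable_mul hY a b)

lemma secondMoment_sub_left (hX : IsSquareIntegrable μ X) (hX' : IsSquareIntegrable μ X')
    (hY : IsSquareIntegrable μ Y) :
    secondMoment μ (fun ω => X ω - X' ω) Y = secondMoment μ X Y - secondMoment μ X' Y := by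
  ext a b
  simp only [secondMoment, Matrix.of_apply, Matrix.sub_apply, Pi.sub_apply, sub_mul]
  exact integral_sub (hX.integrable_mul hY a b) (hX'.integrable_mul hY a b)

lemma secondMoment_mulVec_left [Fintype p] (hX : IsSquareIntegrable μ X)
    (hY : IsSquareIntegrable μ Y) (M : Matrix r p ℝ) :
    secondMoment μ (fun ω => M *ᵥ X ω) Y = M * secondMoment μ X Y := by
  ext a b
  simp only [secondMoment, Matrix.of_apply, Matrix.mul_apply, Matrix.mulVec, dotProduct,
    Finset.sum_mul, mul_assoc]
  rw [integral_finsetSum _ fun c _ => (hX.integrable_mul hY c b).const_mul _]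
  simp only [integral_const_mul]

lemma secondMoment_add_right (hX : IsSquareIntegrable μ X) (hY : IsSquareIntegrable μ Y)
    (hY' : IsSquareIntegrable μ Y') :
    secondMoment μ X (fun ω => Y ω + Y' ω) = secondMoment μ X Y + secondMoment μ X Y' := by
  rw [← secondMoment_transpose, secondMoment_add_left hY hY' hX, Matrix.transpose_add,
    secondMoment_transpose, secondMoment_transpose]

lemma secondMoment_sub_right (hX : IsSquareIntegrable μ X) (hY : IsSquareIntegrable μ Y)
    (hY' : IsSquareIntegrable μ Y') :
    secondMoment μ X (fun ω => Y ω - Y' ω) = secondMoment μ X Y - secondMoment μ X Y' := by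
  rw [← secondMoment_transpose, secondMoment_sub_left hY hY' hX, Matrix.transpose_sub,
    secondMoment_transpose, secondMoment_transpose]

lemma secondMoment_mulVec_right [Fintype q] (hX : IsSquareIntegrable μ X)
    (hY : IsSquareIntegrable μ Y) (M : Matrix r q ℝ) :
    secondMoment μ X (fun ω => M *ᵥ Y ω) = secondMoment μ X Y * Mᵀ := by
  rw [← secondMoment_transpose, secondMoment_mulVec_left hY hX, Matrix.transpose_mul,
    secondMoment_transpose]

lemma secondMoment_self_nonneg (X : Ω → p → ℝ) (a : p) : 0 ≤ secondMoment μ X X a a :=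
  integral_nonneg fun _ => mul_self_nonneg _

/-- From `|xy| ≤ x² + y²`. Cross-covariances are thereby controlled by variances, and their own
recursion need not be estimated. -/
lemma abs_secondMoment_le (hX : IsSquareIntegrable μ X) (hY : IsSquareIntegrable μ Y)
    (a : p) (b : q) :
    |secondMoment μ X Y a b| ≤ secondMoment μ X X a a + secondMoment μ Y Y b b := by
  simp only [secondMoment, Matrix.of_apply]
  have h1 := hX.integrable_mul hX a a
  have h2 := hY.integrable_mul hY b b
  rw [← integral_add h1 h2]
  refine (abs_integral_le_integral_abs).trans
    (integral_mono (hX.integrable_mul hY a b).abs (h1.add h2) fun ω => ?_)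
  rw [abs_le]
  constructor <;> nlinarith [sq_nonneg (X ω a + Y ω b), sq_nonneg (X ω a - Y ω b),
    sq_nonneg (X ω a), sq_nonneg (Y ω b)]

end SecondMoment

/-! ### Remote errors and their covariances -/

namespace FusionSystem

variable {n : ℕ} {ι : Type*} {m d : ι → ℕ} (S : FusionSystem n ι m d)

/-- The cross-covariance of two remote errors as a function of the two holding times, if the
cross-covariance of the local errors is `Γ`. -/
noncomputable def holdCov (i j : ι) (Γ : Matrix (Fin (d i)) (Fin (d j)) ℝ) :
    ℕ → ℕ → Matrix (Fin (d i)) (Fin (d j)) ℝ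
  | 0, 0 => Γ
  | 0, b + 1 => (1 - S.steadyGain i * S.Co i) * S.predict i j (holdCov i j Γ 0 b)
  | a + 1, 0 => S.predict i j (holdCov i j Γ a 0) * (1 - S.steadyGain j * S.Co j)ᵀ
  | a + 1, b + 1 => S.predict i j (holdCov i j Γ a b)

/-- Equal holding times never meet the mixed clauses of `holdCov`, so a plain Lyapunov recursion is
unrolled. -/
lemma holdCov_diag (i : ι) (Γ : Matrix (Fin (d i)) (Fin (d i)) ℝ) (a : ℕ) :
    S.holdCov i i Γ a a = (S.Ao i) ^ a * Γ * ((S.Ao i) ^ a)ᵀ +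
      ∑ s ∈ Finset.range a, (S.Ao i) ^ s * S.Qo i i * ((S.Ao i) ^ s)ᵀ := by
  induction a with
  | zero => simp [holdCov]
  | succ a ih =>
    rw [holdCov, predict, ih, Finset.sum_range_succ', Matrix.mul_add, Matrix.add_mul,
      Matrix.mul_sum, Matrix.sum_mul, add_assoc]
    simp only [pow_succ', Matrix.transpose_mul, Matrix.mul_assoc, pow_zero, Matrix.transpose_one,
      Matrix.mul_one, Matrix.one_mul]

end FusionSystem

namespace FusionInputs

variable {n : ℕ} {ι : Type*} {m d : ι → ℕ} {Ω : Type*}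
  (D : FusionInputs n ι m d Ω) (S : FusionSystem n ι m d)

/-- The error of the remote estimate of `V i' x k` from the packet sent at time `t`. -/
noncomputable def remoteErr (i : ι) (k t : ℕ) (ω : Ω) : Fin (d i) → ℝ :=
  (S.V i)ᵀ *ᵥ D.state S k ω - D.remoteEst S i k t ω

lemma remoteErr_self (i : ι) (k : ℕ) : D.remoteErr S i k k = D.localErr S i k := by
  ext ω
  simp [remoteErr, remoteEst, localErr]

lemma transpose_mulVec_state_succ (i : ι) (hV : IsObservableBasis S.A (S.C i) (S.V i)) (k : ℕ)
    (ω : Ω) : (S.V i)ᵀ *ᵥ D.state S (k + 1) ω =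
      S.Ao i *ᵥ ((S.V i)ᵀ *ᵥ D.state S k ω) + (S.V i)ᵀ *ᵥ D.w k ω := by
  rw [state, Matrix.mulVec_add, Matrix.mulVec_mulVec, Matrix.mulVec_mulVec,
    hV.transpose_mul_eq]
  rfl

lemma remoteErr_succ (i : ι) (hV : IsObservableBasis S.A (S.C i) (S.V i)) {k t : ℕ} (ht : t ≤ k) :
    D.remoteErr S i (k + 1) t = fun ω =>
      S.Ao i *ᵥ D.remoteErr S i k t ω + (S.V i)ᵀ *ᵥ D.w k ω := by
  funext ω
  rw [remoteErr, D.transpose_mulVec_state_succ S i hV, remoteErr, Matrix.mulVec_sub, remoteEst,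
    remoteEst, Nat.succ_sub ht, pow_succ', Matrix.mulVec_mulVec _ (S.Ao i) (S.Ao i ^ (k - t))]
  abel

lemma localErr_succ (i : ι) (hV : IsObservableBasis S.A (S.C i) (S.V i)) (k : ℕ) :
    D.localErr S i (k + 1) = fun ω =>
      (1 - S.steadyGain i * S.Co i) *ᵥ (S.Ao i *ᵥ D.localErr S i k ω + (S.V i)ᵀ *ᵥ D.w k ω) -
        S.steadyGain i *ᵥ D.v i (k + 1) ω := by
  funext ω
  have hobs : D.obs S i (k + 1) ω =
      S.Co i *ᵥ ((S.V i)ᵀ *ᵥ D.state S (k + 1) ω) + D.v i (k + 1) ω := by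
    rw [Matrix.mulVec_mulVec, FusionSystem.Co, hV.mul_proj]
    rfl
  rw [localErr, localEst]
  beta_reduce
  rw [hobs, D.transpose_mulVec_state_succ S i hV, localErr]
  simp only [Matrix.mulVec_sub, Matrix.mulVec_add, Matrix.sub_mulVec, Matrix.one_mulVec,
    ← Matrix.mulVec_mulVec]
  abel

/-- One step of the evolution of the remote error, with or without an arrival. -/
lemma remoteErr_step (i : ι) (hV : IsObservableBasis S.A (S.C i) (S.V i)) {k t : ℕ}
    (ht : t ≤ k + 1) :
    D.remoteErr S i (k + 1) t = fun ω =>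
      (if t = k + 1 then 1 - S.steadyGain i * S.Co i else 1) *ᵥ
          (S.Ao i *ᵥ D.remoteErr S i k (min t k) ω + (S.V i)ᵀ *ᵥ D.w k ω) -
        (if t = k + 1 then S.steadyGain i else 0) *ᵥ D.v i (k + 1) ω := by
  -- `min t k` is `t` for an older packet; for a fresh one it is `k`, the local error from which the
  -- filter takes its step.
  rcases Nat.lt_or_eq_of_le ht with h | rfl
  · rw [D.remoteErr_succ S i hV (Nat.lt_succ_iff.1 h)]
    simp [h.ne, Nat.min_eq_left (Nat.lt_succ_iff.1 h)]
  · rw [remoteErr_self, D.localErr_succ S i hV, Nat.min_eq_right (Nat.le_succ k), remoteErr_self]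
    simp

variable {D S} [MeasurableSpace Ω] {μ : Measure Ω}

lemma isSquareIntegrable_remoteErr (hV : ∀ i, IsObservableBasis S.A (S.C i) (S.V i))
    (hnoise : D.IsWhiteNoise S μ) (hsteady : D.IsSteadyStart S μ) (i : ι) {k t : ℕ}
    (ht : t ≤ k) : IsSquareIntegrable μ (D.remoteErr S i k t) := by
  induction k generalizing t with
  | zero =>
    obtain rfl := Nat.le_zero.1 ht
    rw [remoteErr_self]
    exact (hsteady.centered i).isSquareIntegrable
  | succ k ih =>
    rw [D.remoteErr_step S i (hV i) ht]
    exact ((((ih (min_le_right t k)).mulVec _).add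
      ((hnoise.w_centered k).isSquareIntegrable.mulVec _)).mulVec _).sub
      ((hnoise.v_centered i (k + 1)).isSquareIntegrable.mulVec _)

/-- By time `k` the error contains only the initial error, `w 0, …, w (k - 1)` and `v 1, …, v k`. -/
lemma secondMoment_remoteErr_w (hV : ∀ i, IsObservableBasis S.A (S.C i) (S.V i))
    (hnoise : D.IsWhiteNoise S μ) (hsteady : D.IsSteadyStart S μ) (i : ι) {k t l : ℕ}
    (ht : t ≤ k) (hl : k ≤ l) : secondMoment μ (D.remoteErr S i k t) (D.w l) = 0 := by
  induction k generalizing t with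
  | zero =>
    obtain rfl := Nat.le_zero.1 ht
    rw [remoteErr_self]
    exact hsteady.w_uncorrelated i l
  | succ k ih =>
    have he := isSquareIntegrable_remoteErr hV hnoise hsteady i (min_le_right t k)
    have hw := fun k => (hnoise.w_centered k).isSquareIntegrable
    have hv := fun k => (hnoise.v_centered i k).isSquareIntegrable
    have hvw : secondMoment μ (D.v i (k + 1)) (D.w l) = 0 := by
      rw [← secondMoment_transpose, hnoise.w_v_uncorrelated, Matrix.transpose_zero]
    rw [D.remoteErr_step S i (hV i) ht,
      secondMoment_sub_left (((he.mulVec _).add ((hw k).mulVec _)).mulVec _) ((hv _).mulVec _)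
        (hw l),
      secondMoment_mulVec_left ((he.mulVec _).add ((hw k).mulVec _)) (hw l),
      secondMoment_add_left (he.mulVec _) ((hw k).mulVec _) (hw l),
      secondMoment_mulVec_left he (hw l), secondMoment_mulVec_left (hw k) (hw l),
      secondMoment_mulVec_left (hv _) (hw l), ih (min_le_right t k) (by omega),
      hnoise.w_white k l (by omega), hvw]
    simp

lemma secondMoment_remoteErr_v (hV : ∀ i, IsObservableBasis S.A (S.C i) (S.V i))
    (hnoise : D.IsWhiteNoise S μ) (hsteady : D.IsSteadyStart S μ) (i j : ι) {k t l : ℕ}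
    (ht : t ≤ k) (hl : k ≤ l) :
    secondMoment μ (D.remoteErr S i k t) (D.v j (l + 1)) = 0 := by
  induction k generalizing t with
  | zero =>
    obtain rfl := Nat.le_zero.1 ht
    rw [remoteErr_self]
    exact hsteady.v_uncorrelated i j l
  | succ k ih =>
    have he := isSquareIntegrable_remoteErr hV hnoise hsteady i (min_le_right t k)
    have hw := fun k => (hnoise.w_centered k).isSquareIntegrable
    have hv := fun i k => (hnoise.v_centered i k).isSquareIntegrable
    have hvv : secondMoment μ (D.v i (k + 1)) (D.v j (l + 1)) = 0 := by
      by_cases hij : i = j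
      · subst hij
        exact hnoise.v_white i _ _ (by omega)
      · exact hnoise.v_uncorrelated i j _ _ hij
    rw [D.remoteErr_step S i (hV i) ht,
      secondMoment_sub_left (((he.mulVec _).add ((hw k).mulVec _)).mulVec _) ((hv i _).mulVec _)
        (hv j _),
      secondMoment_mulVec_left ((he.mulVec _).add ((hw k).mulVec _)) (hv j _),
      secondMoment_add_left (he.mulVec _) ((hw k).mulVec _) (hv j _),
      secondMoment_mulVec_left he (hv j _), secondMoment_mulVec_left (hw k) (hv j _),
      secondMoment_mulVec_left (hv i _) (hv j _), ih (min_le_right t k) (by omega),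
      hnoise.w_v_uncorrelated, hvv]
    simp

/-- All cross terms between past errors, process noise and new observation noise vanish. The last
summand survives only if both packets are fresh. -/
lemma secondMoment_remoteErr_step (hV : ∀ i, IsObservableBasis S.A (S.C i) (S.V i))
    (hnoise : D.IsWhiteNoise S μ) (hsteady : D.IsSteadyStart S μ) (i j : ι) {k t u : ℕ}
    (ht : t ≤ k + 1) (hu : u ≤ k + 1) :
    secondMoment μ (D.remoteErr S i (k + 1) t) (D.remoteErr S j (k + 1) u) =
      (if t = k + 1 then 1 - S.steadyGain i * S.Co i else 1) *
          S.predict i j (secondMoment μ (D.remoteErr S i k (min t k))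
            (D.remoteErr S j k (min u k))) *
          (if u = k + 1 then 1 - S.steadyGain j * S.Co j else 1)ᵀ +
        (if t = k + 1 then S.steadyGain i else 0) *
          secondMoment μ (D.v i (k + 1)) (D.v j (k + 1)) *
          (if u = k + 1 then S.steadyGain j else 0)ᵀ := by
  have he := isSquareIntegrable_remoteErr hV hnoise hsteady i (min_le_right t k)
  have hf := isSquareIntegrable_remoteErr hV hnoise hsteady j (min_le_right u k)
  have hw := (hnoise.w_centered k).isSquareIntegrable
  have hv := fun i => (hnoise.v_centered i (k + 1)).isSquareIntegrable
  have hew := secondMoment_remoteErr_w hV hnoise hsteady i (min_le_right t k) le_rfl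
  have hfw := secondMoment_remoteErr_w hV hnoise hsteady j (min_le_right u k) le_rfl
  have hev := secondMoment_remoteErr_v hV hnoise hsteady i j (min_le_right t k) le_rfl
  have hfv := secondMoment_remoteErr_v hV hnoise hsteady j i (min_le_right u k) le_rfl
  rw [← secondMoment_transpose, Matrix.transpose_eq_zero] at hfw hfv
  have hwv := hnoise.w_v_uncorrelated j k (k + 1)
  have hvw := hnoise.w_v_uncorrelated i k (k + 1)
  rw [← secondMoment_transpose, Matrix.transpose_eq_zero] at hvw
  rw [D.remoteErr_step S i (hV i) ht, D.remoteErr_step S j (hV j) hu]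
  generalize (if t = k + 1 then 1 - S.steadyGain i * S.Co i else 1) = Li
  generalize (if u = k + 1 then 1 - S.steadyGain j * S.Co j else 1) = Lj
  generalize (if t = k + 1 then S.steadyGain i else 0) = Bi
  generalize (if u = k + 1 then S.steadyGain j else 0) = Bj
  have hpi := (he.mulVec (S.Ao i)).add (hw.mulVec (S.V i)ᵀ)
  have hpj := (hf.mulVec (S.Ao j)).add (hw.mulVec (S.V j)ᵀ)
  have hright := (hpj.mulVec Lj).sub ((hv j).mulVec Bj)
  have h1 : secondMoment μ
      (fun ω => S.Ao i *ᵥ D.remoteErr S i k (min t k) ω + (S.V i)ᵀ *ᵥ D.w k ω)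
      (fun ω => S.Ao j *ᵥ D.remoteErr S j k (min u k) ω + (S.V j)ᵀ *ᵥ D.w k ω) =
      S.predict i j (secondMoment μ (D.remoteErr S i k (min t k))
            (D.remoteErr S j k (min u k))) := by
    rw [secondMoment_add_left (he.mulVec _) (hw.mulVec _) hpj,
      secondMoment_add_right (he.mulVec _) (hf.mulVec _) (hw.mulVec _),
      secondMoment_add_right (hw.mulVec _) (hf.mulVec _) (hw.mulVec _),
      secondMoment_mulVec_left he (hf.mulVec _), secondMoment_mulVec_left he (hw.mulVec _),
      secondMoment_mulVec_left hw (hf.mulVec _), secondMoment_mulVec_left hw (hw.mulVec _),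
      secondMoment_mulVec_right he hf, secondMoment_mulVec_right he hw,
      secondMoment_mulVec_right hw hf, secondMoment_mulVec_right hw hw, hew, hfw, hnoise.w_cov]
    simp [FusionSystem.predict, FusionSystem.Qo, Matrix.mul_assoc]
  have h2 : secondMoment μ
      (fun ω => S.Ao i *ᵥ D.remoteErr S i k (min t k) ω + (S.V i)ᵀ *ᵥ D.w k ω)
      (D.v j (k + 1)) = 0 := by
    rw [secondMoment_add_left (he.mulVec _) (hw.mulVec _) (hv j),
      secondMoment_mulVec_left he (hv j), secondMoment_mulVec_left hw (hv j), hev, hwv]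
    simp
  have h3 : secondMoment μ (D.v i (k + 1))
      (fun ω => S.Ao j *ᵥ D.remoteErr S j k (min u k) ω + (S.V j)ᵀ *ᵥ D.w k ω) = 0 := by
    rw [secondMoment_add_right (hv i) (hf.mulVec _) (hw.mulVec _),
      secondMoment_mulVec_right (hv i) hf, secondMoment_mulVec_right (hv i) hw, hfv, hvw]
    simp
  rw [secondMoment_sub_left (hpi.mulVec _) ((hv i).mulVec _) hright,
    secondMoment_mulVec_left hpi hright, secondMoment_mulVec_left (hv i) hright,
    secondMoment_sub_right hpi (hpj.mulVec _) ((hv j).mulVec _),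
    secondMoment_sub_right (hv i) (hpj.mulVec _) ((hv j).mulVec _),
    secondMoment_mulVec_right hpi hpj, secondMoment_mulVec_right hpi (hv j),
    secondMoment_mulVec_right (hv i) hpj, secondMoment_mulVec_right (hv i) (hv j), h1, h2, h3]
  simp [Matrix.mul_assoc]

/-- The covariances of the remote errors depend on the holding times only. -/
lemma secondMoment_remoteErr (hQ : S.Q.PosDef) (hR : ∀ i, (S.R i).PosDef)
    (hV : ∀ i, IsObservableBasis S.A (S.C i) (S.V i))
    (hnoise : D.IsWhiteNoise S μ) (hsteady : D.IsSteadyStart S μ) (i j : ι) {k t u : ℕ}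
    (ht : t ≤ k) (hu : u ≤ k) :
    secondMoment μ (D.remoteErr S i k t) (D.remoteErr S j k u) =
      S.holdCov i j (secondMoment μ (D.localErr S i 0) (D.localErr S j 0)) (k - t) (k - u) := by
  induction k generalizing t u with
  | zero =>
    obtain rfl := Nat.le_zero.1 ht
    obtain rfl := Nat.le_zero.1 hu
    rw [remoteErr_self, remoteErr_self, Nat.sub_zero, FusionSystem.holdCov]
  | succ k ih =>
    rw [secondMoment_remoteErr_step hV hnoise hsteady i j ht hu,
      ih (min_le_right t k) (min_le_right u k)]
    rcases Nat.lt_or_eq_of_le ht with h | rfl <;> rcases Nat.lt_or_eq_of_le hu with h' | rfl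
    · rw [min_eq_left (Nat.lt_succ_iff.1 h), min_eq_left (Nat.lt_succ_iff.1 h'),
        Nat.succ_sub (Nat.lt_succ_iff.1 h), Nat.succ_sub (Nat.lt_succ_iff.1 h'),
        FusionSystem.holdCov]
      simp [h.ne, h'.ne]
    · rw [min_eq_left (Nat.lt_succ_iff.1 h), min_eq_right (Nat.le_succ k),
        Nat.succ_sub (Nat.lt_succ_iff.1 h), Nat.sub_self, Nat.sub_self, FusionSystem.holdCov]
      simp [h.ne]
    · rw [min_eq_left (Nat.lt_succ_iff.1 h'), min_eq_right (Nat.le_succ k),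
        Nat.succ_sub (Nat.lt_succ_iff.1 h'), Nat.sub_self, Nat.sub_self, FusionSystem.holdCov]
      simp [h'.ne]
    -- Both packets are fresh: the Joseph equation gives stationarity for `i = j`, and the assumed
    -- invariance of the cross-covariances gives it for `i ≠ j`.
    · rw [min_eq_right (Nat.le_succ k), Nat.sub_self, Nat.sub_self, FusionSystem.holdCov]
      simp only [if_true]
      by_cases hij : i = j
      · subst hij
        rw [hsteady.cov, hnoise.v_cov, S.steadyCov_joseph i hQ (hR i) (hV i)]
      · rw [hnoise.v_uncorrelated i j _ _ hij, Matrix.mul_zero, Matrix.zero_mul, add_zero]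
        exact hsteady.cross i j hij

end FusionInputs

/-! ### Constrained least squares -/

section LeastSquares

variable {E E' H : Type*} [AddCommGroup E] [Module ℝ E]
  [AddCommGroup E'] [Module ℝ E'] [NormedAddCommGroup H] [InnerProductSpace ℝ H]

/-- A linear least squares problem with consistent linear constraints has a solution. -/
lemma exists_constrained_leastSquares [FiniteDimensional ℝ E] (L : E →ₗ[ℝ] H) (c : E →ₗ[ℝ] E') (x₀ : E) :
    ∃ x, c x = c x₀ ∧ ∀ y, c y = c x₀ → ‖L x‖ ^ 2 ≤ ‖L y‖ ^ 2 := by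
  -- `K` collects the changes of the residual along feasible directions. It is finite-dimensional,
  -- so removing the projection of `L x₀` onto it is possible and optimal.
  set K : Submodule ℝ H := (LinearMap.ker c).map L with hK
  obtain ⟨z, hz, hzL⟩ : K.starProjection (L x₀) ∈ K := K.starProjection_apply_mem _
  refine ⟨x₀ - z, by rw [map_sub, LinearMap.mem_ker.1 hz, sub_zero], fun y hy => ?_⟩
  have hmem : L (y - (x₀ - z)) ∈ K := by
    refine ⟨y - (x₀ - z), ?_, rfl⟩
    simp [hy, LinearMap.mem_ker.1 hz]
  have horth : inner ℝ (L (x₀ - z)) (L (y - (x₀ - z))) = 0 := by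
    rw [map_sub, hzL]
    exact K.starProjection_inner_eq_zero _ _ hmem
  have hsum : L y = L (x₀ - z) + L (y - (x₀ - z)) := by rw [← map_add, add_sub_cancel]
  rw [hsum, norm_add_sq_real, horth]
  nlinarith [sq_nonneg ‖L (y - (x₀ - z))‖]

/-- All solutions of a constrained linear least squares problem have the same residual. -/
lemma constrained_leastSquares_unique (L : E →ₗ[ℝ] H) (c : E →ₗ[ℝ] E') {x y : E}
    (hxy : c x = c y) (hx : ∀ z, c z = c x → ‖L x‖ ^ 2 ≤ ‖L z‖ ^ 2)
    (hy : ∀ z, c z = c x → ‖L y‖ ^ 2 ≤ ‖L z‖ ^ 2) : L x = L y := by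
  -- The midpoint is feasible; by the parallelogram law it would beat two distinct optimal
  -- residuals.
  have hmid : c ((1 / 2 : ℝ) • (x + y)) = c x := by
    rw [map_smul, map_add, ← hxy, ← two_smul ℝ (c x), smul_smul]
    norm_num
  have h1 := hx _ hmid
  have h2 := hy x rfl
  have h3 := hx y hxy.symm
  rw [map_smul, map_add, norm_smul, mul_pow] at h1
  have h4 := parallelogram_law_with_norm ℝ (L x) (L y)
  norm_num at h1
  have h5 : ‖L x - L y‖ ^ 2 ≤ 0 := by nlinarith
  have h6 : ‖L x - L y‖ = 0 := by
    have := sq_nonneg ‖L x - L y‖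
    exact pow_eq_zero_iff (two_ne_zero) |>.1 (le_antisymm h5 this)
  exact sub_eq_zero.1 (norm_eq_zero.1 h6)

end LeastSquares

/-! ### The fusion problem as least squares in `L²` -/

section SecondMomentSum

variable {Ω : Type*} [MeasurableSpace Ω] {μ : Measure Ω} {p q κ : Type*}

lemma IsSquareIntegrable.sum {s : Finset κ} {X : κ → Ω → p → ℝ}
    (hX : ∀ i ∈ s, IsSquareIntegrable μ (X i)) :
    IsSquareIntegrable μ fun ω => ∑ i ∈ s, X i ω := fun a => by
  simp only [Finset.sum_apply]
  exact memLp_finsetSum _ fun i hi => hX i hi a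

lemma secondMoment_sum_left {s : Finset κ} {X : κ → Ω → p → ℝ} {Y : Ω → q → ℝ}
    (hX : ∀ i ∈ s, IsSquareIntegrable μ (X i)) (hY : IsSquareIntegrable μ Y) :
    secondMoment μ (fun ω => ∑ i ∈ s, X i ω) Y = ∑ i ∈ s, secondMoment μ (X i) Y := by
  ext a b
  simp only [secondMoment, Matrix.of_apply, Finset.sum_apply, Finset.sum_mul, Matrix.sum_apply]
  exact integral_finsetSum _ fun i hi => (hX i hi).integrable_mul hY a b

lemma secondMoment_sum_right {s : Finset κ} {X : Ω → p → ℝ} {Y : κ → Ω → q → ℝ}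
    (hX : IsSquareIntegrable μ X) (hY : ∀ i ∈ s, IsSquareIntegrable μ (Y i)) :
    secondMoment μ X (fun ω => ∑ i ∈ s, Y i ω) = ∑ i ∈ s, secondMoment μ X (Y i) := by
  rw [← secondMoment_transpose, secondMoment_sum_left hY hX, Matrix.transpose_sum]
  simp only [secondMoment_transpose]

lemma secondMoment_eq_inner {X : Ω → p → ℝ} {Y : Ω → q → ℝ} (hX : IsSquareIntegrable μ X)
    (hY : IsSquareIntegrable μ Y) (a : p) (b : q) :
    secondMoment μ X Y a b = inner ℝ ((hX a).toLp _) ((hY b).toLp _) := by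
  rw [L2.inner_def, secondMoment, Matrix.of_apply]
  refine integral_congr_ae ?_
  filter_upwards [(hX a).coeFn_toLp, (hY b).coeFn_toLp] with ω h1 h2
  rw [h1, h2]
  simp [mul_comm]

end SecondMomentSum

section Fusion

variable {n : ℕ} {ι : Type*} [Fintype ι] {d : ι → ℕ}

/-- The covariance of `∑ i, U i V i e i`, where `e i` and `e j` have cross-covariance `G i j`. -/
def combinedCov (V : (i : ι) → Matrix (Fin n) (Fin (d i)) ℝ)
    (G : (i j : ι) → Matrix (Fin (d i)) (Fin (d j)) ℝ) (U : ι → Matrix (Fin n) (Fin n) ℝ) :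
    Matrix (Fin n) (Fin n) ℝ :=
  ∑ i, ∑ j, U i * V i * G i j * (U j * V j)ᵀ

/-- The constraint map `U ↦ ∑ i, U i V i V i'` of the fusion problem. -/
def fusionConstraint (V : (i : ι) → Matrix (Fin n) (Fin (d i)) ℝ) :
    (ι → Matrix (Fin n) (Fin n) ℝ) →ₗ[ℝ] Matrix (Fin n) (Fin n) ℝ where
  toFun U := ∑ i, U i * V i * (V i)ᵀ
  map_add' U U' := by
    simp only [Pi.add_apply, Matrix.add_mul, Finset.sum_add_distrib]
  map_smul' c U := by
    simp only [Pi.smul_apply, Matrix.smul_mul, Finset.smul_sum, RingHom.id_apply]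

/-- The fused error as a linear function of the fusion coefficients. -/
noncomputable def fusionResidual {H : Type*} [NormedAddCommGroup H] [InnerProductSpace ℝ H]
    (V : (i : ι) → Matrix (Fin n) (Fin (d i)) ℝ) (h : (i : ι) → Fin (d i) → H) :
    (ι → Matrix (Fin n) (Fin n) ℝ) →ₗ[ℝ] PiLp 2 (fun _ : Fin n => H) where
  toFun U := WithLp.toLp 2 fun a => ∑ i, ∑ b, (U i * V i) a b • h i b
  map_add' U U' := by
    ext a
    simp [Matrix.add_mul, add_smul, Finset.sum_add_distrib]
  map_smul' c U := by
    ext a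
    simp [Matrix.smul_mul, smul_smul, Finset.smul_sum]

variable {H : Type*} [NormedAddCommGroup H] [InnerProductSpace ℝ H]
  {V : (i : ι) → Matrix (Fin n) (Fin (d i)) ℝ} {h : (i : ι) → Fin (d i) → H}
  {G : (i j : ι) → Matrix (Fin (d i)) (Fin (d j)) ℝ}

lemma combinedCov_eq_inner (hG : ∀ i j b c, G i j b c = inner ℝ (h i b) (h j c))
    (U : ι → Matrix (Fin n) (Fin n) ℝ) (a a' : Fin n) :
    combinedCov V G U a a' =
      inner ℝ (fusionResidual V h U a) (fusionResidual V h U a') := by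
  simp only [fusionResidual, LinearMap.coe_mk, AddHom.coe_mk, combinedCov, Matrix.sum_apply,
    sum_inner]
  refine Finset.sum_congr rfl fun i _ => ?_
  simp only [inner_sum, inner_smul_left, inner_smul_right, ← hG]
  rw [Finset.sum_comm]
  refine Finset.sum_congr rfl fun j _ => ?_
  rw [Matrix.mul_apply, Finset.sum_comm]
  refine Finset.sum_congr rfl fun c _ => ?_
  rw [Matrix.mul_apply, Finset.sum_mul]
  refine Finset.sum_congr rfl fun b _ => ?_
  simp only [Matrix.transpose_apply, conj_trivial]
  ring

lemma trace_combinedCov_eq_norm_sq (hG : ∀ i j b c, G i j b c = inner ℝ (h i b) (h j c))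
    (U : ι → Matrix (Fin n) (Fin n) ℝ) :
    (combinedCov V G U).trace = ‖fusionResidual V h U‖ ^ 2 := by
  rw [PiLp.norm_sq_eq_of_L2, Matrix.trace]
  refine Finset.sum_congr rfl fun a _ => ?_
  rw [Matrix.diag_apply, combinedCov_eq_inner hG, real_inner_self_eq_norm_sq]

/-- For fixed weights the trace is linear in `G`, so `κ` depends on `U` and `V` alone. -/
lemma abs_trace_combinedCov_le (V : (i : ι) → Matrix (Fin n) (Fin (d i)) ℝ)
    (U : ι → Matrix (Fin n) (Fin n) ℝ) :
    ∃ κ : ℝ, 0 ≤ κ ∧ ∀ (G : (i j : ι) → Matrix (Fin (d i)) (Fin (d j)) ℝ) (B : ℝ),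
      (∀ i j b c, |G i j b c| ≤ B) → |(combinedCov V G U).trace| ≤ κ * B := by
  refine ⟨∑ a, ∑ i, ∑ j, ∑ c, ∑ b, |(U i * V i) a b| * |(U j * V j) a c|, by positivity,
    fun G B hB => ?_⟩
  have hexpand : ∀ T : (i : ι) → Matrix (Fin n) (Fin (d i)) ℝ,
      (∑ i, ∑ j, T i * G i j * (T j)ᵀ).trace =
        ∑ a, ∑ i, ∑ j, ∑ c, ∑ b, T i a b * G i j b c * T j a c := fun T => by
    simp only [Matrix.trace, Matrix.diag_apply, Matrix.sum_apply, Matrix.mul_apply,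
      Finset.sum_mul, Matrix.transpose_apply]
  rw [combinedCov, hexpand fun i => U i * V i]
  simp only [Finset.sum_mul]
  refine (Finset.abs_sum_le_sum_abs _ _).trans (Finset.sum_le_sum fun a _ => ?_)
  refine (Finset.abs_sum_le_sum_abs _ _).trans (Finset.sum_le_sum fun i _ => ?_)
  refine (Finset.abs_sum_le_sum_abs _ _).trans (Finset.sum_le_sum fun j _ => ?_)
  refine (Finset.abs_sum_le_sum_abs _ _).trans (Finset.sum_le_sum fun c _ => ?_)
  refine (Finset.abs_sum_le_sum_abs _ _).trans (Finset.sum_le_sum fun b _ => ?_)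
  rw [abs_mul, abs_mul, mul_right_comm]
  exact mul_le_mul_of_nonneg_left (hB i j b c) (by positivity)

end Fusion

namespace FusionInputs

variable {n : ℕ} {ι : Type*} [Fintype ι] {m d : ι → ℕ} {Ω : Type*}
  {D : FusionInputs n ι m d Ω} {S : FusionSystem n ι m d}

/-- The constraint rewrites the state as `∑ Uᵢ Vᵢ Vᵢ' x`, so no multiple of the possibly unbounded
state remains. -/
lemma fusedErr_eq {U : ι → Matrix (Fin n) (Fin n) ℝ} (hU : fusionConstraint S.V U = 1) (k : ℕ)
    (t : ι → ℕ) :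
    D.fusedErr S U k t = fun ω => ∑ i, (U i * S.V i) *ᵥ D.remoteErr S i k (t i) ω := by
  funext ω
  have h1 : ∑ i, (U i * S.V i) *ᵥ ((S.V i)ᵀ *ᵥ D.state S k ω) = D.state S k ω := by
    simp only [Matrix.mulVec_mulVec]
    rw [← Matrix.sum_mulVec]
    exact (congrArg (· *ᵥ D.state S k ω) hU).trans (Matrix.one_mulVec _)
  simp only [fusedErr, remoteErr, Matrix.mulVec_sub, Finset.sum_sub_distrib, h1]
  simp only [Matrix.mulVec_mulVec]

variable [MeasurableSpace Ω] {μ : Measure Ω}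

lemma fusedCov_eq (hV : ∀ i, IsObservableBasis S.A (S.C i) (S.V i))
    (hnoise : D.IsWhiteNoise S μ) (hsteady : D.IsSteadyStart S μ)
    {U : ι → Matrix (Fin n) (Fin n) ℝ} (hU : fusionConstraint S.V U = 1) {k : ℕ}
    {t : ι → ℕ} (ht : ∀ i, t i ≤ k) :
    D.fusedCov S μ U k t = combinedCov S.V
      (fun i j => secondMoment μ (D.remoteErr S i k (t i)) (D.remoteErr S j k (t j))) U := by
  have he := fun i => isSquareIntegrable_remoteErr hV hnoise hsteady i (ht i)
  have hs := IsSquareIntegrable.sum (s := Finset.univ) fun i _ => (he i).mulVec (U i * S.V i)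
  rw [fusedCov, fusedErr_eq hU, combinedCov,
    secondMoment_sum_left (fun i _ => (he i).mulVec (U i * S.V i)) hs]
  refine Finset.sum_congr rfl fun i _ => ?_
  rw [secondMoment_sum_right ((he i).mulVec _) (fun i _ => (he i).mulVec (U i * S.V i))]
  refine Finset.sum_congr rfl fun j _ => ?_
  rw [secondMoment_mulVec_left (he i) ((he j).mulVec _), secondMoment_mulVec_right (he i) (he j)]
  simp only [Matrix.mul_assoc]

/-- On the feasible set the fused error covariance is the Gram matrix of a linear residual. -/
lemma exists_residual (hV : ∀ i, IsObservableBasis S.A (S.C i) (S.V i))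
    (hnoise : D.IsWhiteNoise S μ) (hsteady : D.IsSteadyStart S μ) {k : ℕ}
    {t : ι → ℕ} (ht : ∀ i, t i ≤ k) :
    ∃ L : (ι → Matrix (Fin n) (Fin n) ℝ) →ₗ[ℝ] PiLp 2 (fun _ : Fin n => Lp ℝ 2 μ),
      ∀ U, fusionConstraint S.V U = 1 →
        (∀ a b, D.fusedCov S μ U k t a b = inner ℝ (L U a) (L U b)) ∧
          (D.fusedCov S μ U k t).trace = ‖L U‖ ^ 2 := by
  have he := fun i => isSquareIntegrable_remoteErr hV hnoise hsteady i (ht i)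
  refine ⟨fusionResidual S.V fun i b => (he i b).toLp _, fun U hU => ?_⟩
  rw [fusedCov_eq hV hnoise hsteady hU ht]
  exact ⟨combinedCov_eq_inner (fun i j b c => secondMoment_eq_inner (he i) (he j) b c) U,
    trace_combinedCov_eq_norm_sq (fun i j b c => secondMoment_eq_inner (he i) (he j) b c) U⟩

lemma exists_isOptimalFusion (hV : ∀ i, IsObservableBasis S.A (S.C i) (S.V i))
    (hobs : IsObservablePair S.A S.stackedC)
    (hnoise : D.IsWhiteNoise S μ) (hsteady : D.IsSteadyStart S μ) {k : ℕ}
    {t : ι → ℕ} (ht : ∀ i, t i ≤ k) : ∃ W, D.IsOptimalFusion S μ k t W := by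
  obtain ⟨L, hL⟩ := exists_residual hV hnoise hsteady ht
  obtain ⟨W₀, hW₀⟩ := S.exists_feasible hV hobs
  obtain ⟨W, hW, hmin⟩ := exists_constrained_leastSquares L (fusionConstraint S.V) (fun _ => W₀)
  have h0 : fusionConstraint S.V (fun _ => W₀) = 1 := hW₀
  rw [h0] at hW hmin
  refine ⟨W, isMinOn_iff.2 fun U hU => ?_, hW⟩
  rw [(hL W hW).2, (hL U hU).2]
  exact hmin U hU

/-- Minimizers need not be unique, but their residual is, and the whole covariance matrix is its
Gram matrix. -/
lemma IsOptimalFusion.fusedCov_eq (hV : ∀ i, IsObservableBasis S.A (S.C i) (S.V i))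
    (hnoise : D.IsWhiteNoise S μ) (hsteady : D.IsSteadyStart S μ) {k : ℕ}
    {t : ι → ℕ} (ht : ∀ i, t i ≤ k) {W W' : ι → Matrix (Fin n) (Fin n) ℝ}
    (hW : D.IsOptimalFusion S μ k t W) (hW' : D.IsOptimalFusion S μ k t W') :
    D.fusedCov S μ W k t = D.fusedCov S μ W' k t := by
  obtain ⟨L, hL⟩ := exists_residual hV hnoise hsteady ht
  have hf : fusionConstraint S.V W = 1 := hW.2
  have hf' : fusionConstraint S.V W' = 1 := hW'.2
  have hmin : ∀ {X}, D.IsOptimalFusion S μ k t X →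
      ∀ Z, fusionConstraint S.V Z = fusionConstraint S.V W → ‖L X‖ ^ 2 ≤ ‖L Z‖ ^ 2 := by
    intro X hX Z hZ
    rw [hf] at hZ
    rw [← (hL X hX.2).2, ← (hL Z hZ).2]
    exact isMinOn_iff.1 hX.1 Z hZ
  have h := constrained_leastSquares_unique L (fusionConstraint S.V) (hf.trans hf'.symm)
    (hmin hW) (hmin hW')
  ext a b
  rw [(hL W hf).1, (hL W' hf').1, h]

end FusionInputs

/-! ### Geometric growth in the holding time -/

section EntryBounds

lemma abs_mul_mul_entry_le {p q r s : Type*} [Fintype q] [Fintype r] {M : Matrix p q ℝ}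
    {N : Matrix r s ℝ} {α β : ℝ} (hα : 0 ≤ α) (hM : ∀ a b, |M a b| ≤ α)
    (hN : ∀ a b, |N a b| ≤ β) (X : Matrix q r ℝ) (a : p) (b : s) :
    |(M * X * N) a b| ≤ α * β * ∑ e, ∑ c, |X c e| := by
  simp only [Matrix.mul_apply, Finset.sum_mul, Finset.mul_sum]
  refine (Finset.abs_sum_le_sum_abs _ _).trans (Finset.sum_le_sum fun e _ => ?_)
  refine (Finset.abs_sum_le_sum_abs _ _).trans (Finset.sum_le_sum fun c _ => ?_)
  rw [abs_mul, abs_mul, mul_right_comm]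
  exact mul_le_mul_of_nonneg_right
    (mul_le_mul (hM a c) (hN e b) (abs_nonneg _) hα) (abs_nonneg _)

lemma exists_entry_bound {p q : Type*} [Fintype p] [Fintype q] (M : Matrix p q ℝ) :
    ∃ c : ℝ, 0 ≤ c ∧ ∀ a b, |M a b| ≤ c := by
  refine ⟨∑ a, ∑ b, |M a b|, by positivity, fun a b => ?_⟩
  exact (Finset.single_le_sum (f := fun b => |M a b|) (fun _ _ => abs_nonneg _)
    (Finset.mem_univ b)).trans (Finset.single_le_sum (f := fun a => ∑ b, |M a b|)
      (fun _ _ => Finset.sum_nonneg fun _ _ => abs_nonneg _) (Finset.mem_univ a))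

end EntryBounds

namespace FusionSystem

variable {n : ℕ} {ι : Type*} {m d : ι → ℕ} (S : FusionSystem n ι m d)

lemma exists_abs_Ao_pow_entry_le (i : ι) (hV : IsObservableBasis S.A (S.C i) (S.V i)) {b : ℝ}
    (hb : specRad S.A < b) :
    ∃ c : ℝ, 0 ≤ c ∧ ∀ s a a', |(S.Ao i ^ s) a a'| ≤ c * b ^ s := by
  obtain ⟨c, hc0, hc⟩ := exists_abs_pow_entry_le S.A hb
  obtain ⟨v, hv0, hv⟩ := exists_entry_bound (S.V i)
  have hb0 : 0 < b := (specRad_nonneg S.A).trans_lt hb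
  refine ⟨v * v * (n * (n * c)), by positivity, fun s a a' => ?_⟩
  rw [Ao, hV.reduced_pow]
  refine (abs_mul_mul_entry_le hv0 (fun a b => hv b a) hv (S.A ^ s) a a').trans ?_
  rw [mul_assoc (v * v)]
  refine mul_le_mul_of_nonneg_left ?_ (by positivity)
  refine (Finset.sum_le_sum fun e _ => Finset.sum_le_sum fun f _ => hc s f e).trans_eq ?_
  simp
  ring

/-- The covariance of a remote error grows at most geometrically with the holding time. -/
lemma exists_abs_holdCov_diag_le (i : ι) (hV : IsObservableBasis S.A (S.C i) (S.V i)) {b : ℝ}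
    (hb : specRad S.A < b) (hb1 : 1 < b) (Γ : Matrix (Fin (d i)) (Fin (d i)) ℝ) :
    ∃ c : ℝ, 0 ≤ c ∧ ∀ τ a a', |S.holdCov i i Γ τ τ a a'| ≤ c * (b ^ 2) ^ τ := by
  obtain ⟨c, hc0, hc⟩ := S.exists_abs_Ao_pow_entry_le i hV hb
  have hb0 : 0 < b := one_pos.trans hb1
  have hr1 : 1 < b ^ 2 := by nlinarith
  set Φ : Matrix (Fin (d i)) (Fin (d i)) ℝ → ℝ := fun X => c * c * ∑ e, ∑ f, |X f e| with hΦ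
  have hΦ0 : ∀ X, 0 ≤ Φ X := fun X => by positivity
  have hterm : ∀ (X : Matrix (Fin (d i)) (Fin (d i)) ℝ) (s : ℕ) a a',
      |(S.Ao i ^ s * X * (S.Ao i ^ s)ᵀ) a a'| ≤ Φ X * (b ^ 2) ^ s := fun X s a a' => by
    refine (abs_mul_mul_entry_le (by positivity) (hc s) (fun x y => hc s y x) X a a').trans_eq ?_
    rw [hΦ, ← pow_mul, mul_comm 2 s, pow_mul]
    ring
  refine ⟨Φ Γ + Φ (S.Qo i i) / (b ^ 2 - 1), ?_, fun τ a a' => ?_⟩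
  · exact add_nonneg (hΦ0 _) (div_nonneg (hΦ0 _) (by linarith))
  · rw [S.holdCov_diag, Matrix.add_apply, Matrix.sum_apply, add_mul]
    refine (abs_add_le _ _).trans (add_le_add (hterm _ _ _ _) ?_)
    refine (Finset.abs_sum_le_sum_abs _ _).trans
      ((Finset.sum_le_sum fun s _ => hterm _ s a a').trans ?_)
    rw [← Finset.mul_sum, geom_sum_eq hr1.ne', div_mul_eq_mul_div, mul_div_assoc]
    refine mul_le_mul_of_nonneg_left ?_ (hΦ0 _)
    exact div_le_div_of_nonneg_right (by linarith) (by linarith)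

end FusionSystem

/-- The condition is strict, so it survives a small increase of `max ρ 1`; at the value `1` it holds
because `lam > 0`. Exceeding `ρ` absorbs polynomial factors in the powers of `A`, and `b > 1` lets
products dominate their factors. -/
lemma exists_growth_rate {ρ lam : ℝ} (hlam : 0 < lam) (h : (1 - lam) * ρ ^ 2 < 1) :
    ∃ b, ρ < b ∧ 1 < b ∧ (1 - lam) * b ^ 2 < 1 := by
  have h0 : (1 - lam) * (max ρ 1) ^ 2 < 1 := by
    rcases max_choice ρ 1 with h' | h' <;> rw [h']
    · exact h
    · linarith
  have hc : Tendsto (fun b : ℝ => (1 - lam) * b ^ 2) (𝓝[>] (max ρ 1))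
      (𝓝 ((1 - lam) * (max ρ 1) ^ 2)) :=
    ((by fun_prop : Continuous fun b : ℝ => (1 - lam) * b ^ 2).tendsto _).mono_left
      nhdsWithin_le_nhds
  obtain ⟨b, hb1, hb2⟩ := ((hc.eventually_lt_const h0).and self_mem_nhdsWithin).exists
  exact ⟨b, (le_max_left _ _).trans_lt hb2, (le_max_right _ _).trans_lt hb2, hb1⟩

/-! ### Law of the holding times and convergence of expectations -/

/-- Every finite set of exponents lies in a box, over which the sum factors into partial geometric
series. -/
lemma summable_prod_pow {ι : Type*} [Fintype ι] {q : ι → ℝ} (h0 : ∀ i, 0 ≤ q i)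
    (h1 : ∀ i, q i < 1) : Summable fun τ : ι → ℕ => ∏ i, q i ^ τ i := by
  classical
  refine summable_of_sum_le (c := ∏ i, (1 - q i)⁻¹)
    (fun τ => Finset.prod_nonneg fun i _ => pow_nonneg (h0 i) _) fun u => ?_
  set N := u.sup fun τ => ∑ i, τ i with hN
  have hsub : u ⊆ Fintype.piFinset fun _ : ι => Finset.range (N + 1) := by
    intro τ hτ
    refine Fintype.mem_piFinset.2 fun i => Finset.mem_range.2 (Nat.lt_succ_of_le ?_)
    exact (Finset.single_le_sum (f := τ) (fun _ _ => Nat.zero_le _) (Finset.mem_univ i)).trans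
      (Finset.le_sup (f := fun τ : ι → ℕ => ∑ i, τ i) hτ)
  refine (Finset.sum_le_sum_of_subset_of_nonneg hsub fun τ _ _ =>
    Finset.prod_nonneg fun i _ => pow_nonneg (h0 i) _).trans ?_
  rw [← Finset.prod_univ_sum (fun _ => Finset.range (N + 1)) fun i s => q i ^ s]
  refine Finset.prod_le_prod (fun i _ => Finset.sum_nonneg fun s _ => pow_nonneg (h0 i) _)
    fun i _ => ?_
  rw [← tsum_geometric_of_lt_one (h0 i) (h1 i)]
  exact (summable_geometric_of_lt_one (h0 i) (h1 i)).sum_le_tsum _ fun s _ => pow_nonneg (h0 i) _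

section Arrivals

variable {ι Ω : Type*} {γ : ι → ℕ → Ω → Bool}

lemma lastArrival_le (γ : ι → ℕ → Ω → Bool) (k : ℕ) (ω : Ω) (i : ι) : lastArrival γ k ω i ≤ k :=
  Nat.findGreatest_le k

/-- A cylinder event, ready for independence: no condition before `t i`, an arrival at `t i`, none
afterwards. At `t i = 0` no arrival is required, since `0` is also the default. -/
lemma setOf_lastArrival_eq [Fintype ι] {k : ℕ} {t : ι → ℕ} (ht : ∀ i, t i ≤ k) :
    {ω | lastArrival γ k ω = t} =
      ⋂ p ∈ (Finset.univ : Finset ι) ×ˢ Finset.range (k + 1), (fun ω => γ p.1 p.2 ω) ⁻¹'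
        (if p.2 < t p.1 then Set.univ else
          if p.2 = t p.1 then (if t p.1 = 0 then Set.univ else {true}) else {false}) := by
  ext ω
  simp only [Set.mem_ofPred_eq, funext_iff, lastArrival, Nat.findGreatest_eq_iff, Set.mem_iInter,
    Finset.mem_product, Finset.mem_univ, true_and, Finset.mem_range, Prod.forall]
  refine forall_congr' fun i => ⟨fun h u hu => ?_, fun h => ⟨ht i, fun h0 => ?_, fun u h1 h2 => ?_⟩⟩
  · rcases lt_trichotomy u (t i) with h' | h' | h'
    · simp [h']
    · by_cases h0 : t i = 0
      · simp [h', h0]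
      · simp [h', h0, h.2.1 h0]
    · have := h.2.2 h' (Nat.lt_succ_iff.1 hu)
      simpa [h'.not_gt, h'.ne'] using this
  · simpa [h0] using h (t i) (Nat.lt_succ_of_le (ht i))
  · simpa [h1.not_gt, h1.ne'] using h u (Nat.lt_succ_of_le h2)

/-- A function of the last arrival times is a finite combination of indicators. -/
lemma comp_lastArrival_eq_sum_indicator [Fintype ι] [DecidableEq ι] (k : ℕ) (f : (ι → ℕ) → ℝ) :
    (fun ω => f (lastArrival γ k ω)) =
      fun ω => ∑ t ∈ Fintype.piFinset fun _ : ι => Finset.range (k + 1),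
        {ω | lastArrival γ k ω = t}.indicator (fun _ => f t) ω := by
  funext ω
  rw [Finset.sum_eq_single_of_mem (lastArrival γ k ω)]
  · simp
  · exact Fintype.mem_piFinset.2 fun i =>
      Finset.mem_range.2 (Nat.lt_succ_of_le (lastArrival_le γ k ω i))
  · intro t _ hne
    exact Set.indicator_of_notMem (fun h : lastArrival γ k ω = t => hne h.symm) _

variable [MeasurableSpace Ω] {ν : Measure Ω} {rate : ι → ℝ}

namespace IsBernoulliArrivals

lemma real_preimage_true (hγ : IsBernoulliArrivals ν rate γ) (i : ι) (t : ℕ) :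
    ν.real (γ i t ⁻¹' {true}) = rate i := hγ.prob i t

lemma real_preimage_false [IsProbabilityMeasure ν] (hγ : IsBernoulliArrivals ν rate γ) (i : ι)
    (t : ℕ) : ν.real (γ i t ⁻¹' {false}) = 1 - rate i := by
  rw [← hγ.real_preimage_true i t, ← probReal_compl_eq_one_sub (hγ.measurable i t (measurableSet_singleton true))]
  congr 1
  ext ω
  simp

/-- The joint law of the last arrival times. -/
lemma real_lastArrival_eq [Fintype ι] [IsProbabilityMeasure ν] (hγ : IsBernoulliArrivals ν rate γ)
    {k : ℕ} {t : ι → ℕ} (ht : ∀ i, t i ≤ k) :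
    ν.real {ω | lastArrival γ k ω = t} =
      ∏ i, (if t i = 0 then 1 else rate i) * (1 - rate i) ^ (k - t i) := by
  rw [setOf_lastArrival_eq ht, measureReal_def,
    hγ.indep.measure_inter_preimage_eq_mul _ fun _ _ => MeasurableSet.of_discrete,
    ENNReal.toReal_prod, Finset.prod_product]
  refine Finset.prod_congr rfl fun i _ => ?_
  -- Times split into those before, at and after the last arrival.
  have hk : k + 1 = t i + ((k - t i) + 1) := by have := ht i; omega
  rw [hk, Finset.prod_range_add, Finset.prod_range_succ']
  have h1 : ∀ x ∈ Finset.range (t i), (ν ((fun ω => γ i x ω) ⁻¹'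
      (if x < t i then Set.univ else
        if x = t i then (if t i = 0 then Set.univ else {true}) else {false}))).toReal = 1 := by
    intro x hx
    rw [if_pos (Finset.mem_range.1 hx), Set.preimage_univ, measure_univ, ENNReal.toReal_one]
  have h2 : ∀ x ∈ Finset.range (k - t i), (ν ((fun ω => γ i (t i + (x + 1)) ω) ⁻¹'
      (if t i + (x + 1) < t i then Set.univ else
        if t i + (x + 1) = t i then (if t i = 0 then Set.univ else {true})
          else {false}))).toReal = 1 - rate i := by
    intro x _
    rw [if_neg (by omega), if_neg (by omega)]
    exact hγ.real_preimage_false i _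
  have h3 : (ν ((fun ω => γ i (t i + 0) ω) ⁻¹'
      (if t i + 0 < t i then Set.univ else
        if t i + 0 = t i then (if t i = 0 then Set.univ else {true})
          else {false}))).toReal = if t i = 0 then 1 else rate i := by
    rw [if_neg (by omega), if_pos (by omega)]
    split_ifs
    · rw [Set.preimage_univ, measure_univ, ENNReal.toReal_one]
    · exact hγ.real_preimage_true i _
  rw [Finset.prod_congr rfl h1, Finset.prod_congr rfl h2, h3]
  simp [mul_comm]

lemma measurableSet_lastArrival_eq [Fintype ι] (hγ : IsBernoulliArrivals ν rate γ) {k : ℕ}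
    {t : ι → ℕ} (ht : ∀ i, t i ≤ k) : MeasurableSet {ω | lastArrival γ k ω = t} := by
  rw [setOf_lastArrival_eq ht]
  exact Finset.measurableSet_biInter _ fun p _ => hγ.measurable p.1 p.2 MeasurableSet.of_discrete

open Classical in
/-- The holding times are, by time `k`, geometric variables truncated at `k`. -/
lemma real_holdingTime_eq [Fintype ι] [IsProbabilityMeasure ν]
    (hγ : IsBernoulliArrivals ν rate γ) (k : ℕ) (τ : ι → ℕ) :
    ν.real {ω | (fun i => k - lastArrival γ k ω i) = τ} =
      if ∀ i, τ i ≤ k then ∏ i, (if τ i = k then 1 else rate i) * (1 - rate i) ^ τ i else 0 := by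
  split_ifs with h
  · have hset : {ω | (fun i => k - lastArrival γ k ω i) = τ} =
        {ω | lastArrival γ k ω = fun i => k - τ i} := by
      ext ω
      simp only [Set.mem_ofPred_eq, funext_iff]
      refine forall_congr' fun i => ?_
      have := lastArrival_le γ k ω i
      have := h i
      omega
    rw [hset, hγ.real_lastArrival_eq fun i => Nat.sub_le _ _]
    refine Finset.prod_congr rfl fun i _ => ?_
    have h1 : (k - τ i = 0) = (τ i = k) := by have := h i; exact propext (by omega)
    rw [Nat.sub_sub_self (h i)]
    simp only [h1]
  · have hset : {ω | (fun i => k - lastArrival γ k ω i) = τ} = ∅ := by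
      refine Set.eq_empty_of_forall_notMem fun ω hω => h fun i => ?_
      rw [← congrFun hω i]
      exact Nat.sub_le _ _
    rw [hset, measureReal_empty]

lemma integrable_comp_lastArrival [Fintype ι] [IsProbabilityMeasure ν]
    (hγ : IsBernoulliArrivals ν rate γ) (k : ℕ) (f : (ι → ℕ) → ℝ) :
    Integrable (fun ω => f (lastArrival γ k ω)) ν := by
  classical
  rw [comp_lastArrival_eq_sum_indicator]
  refine integrable_finsetSum _ fun t ht => (integrable_const _).indicator
    (hγ.measurableSet_lastArrival_eq fun i => ?_)
  exact Nat.lt_succ_iff.1 (Finset.mem_range.1 (Fintype.mem_piFinset.1 ht i))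

/-- A finite sum in disguise, indexed by all of `ι → ℕ` so that the index set does not move with
`k`. -/
lemma integral_holdingTime_eq_tsum [Fintype ι] [IsProbabilityMeasure ν]
    (hγ : IsBernoulliArrivals ν rate γ) (k : ℕ) (f : (ι → ℕ) → ℝ) :
    ∫ ω, f (fun i => k - lastArrival γ k ω i) ∂ν =
      ∑' τ, ν.real {ω | (fun i => k - lastArrival γ k ω i) = τ} * f τ := by
  classical
  have hle : ∀ t ∈ Fintype.piFinset fun _ : ι => Finset.range (k + 1), ∀ i, t i ≤ k :=
    fun t ht i => Nat.lt_succ_iff.1 (Finset.mem_range.1 (Fintype.mem_piFinset.1 ht i))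
  have h := comp_lastArrival_eq_sum_indicator (γ := γ) k fun t => f fun i => k - t i
  rw [h, integral_finsetSum _ fun t ht => (integrable_const _).indicator
    (hγ.measurableSet_lastArrival_eq (hle t ht)),
    tsum_eq_sum (s := Fintype.piFinset fun _ : ι => Finset.range (k + 1))]
  · refine Finset.sum_bij' (fun t _ i => k - t i) (fun t _ i => k - t i) ?_ ?_ ?_ ?_ ?_
    · exact fun t _ => Fintype.mem_piFinset.2 fun i => Finset.mem_range.2 (by omega)
    · exact fun t _ => Fintype.mem_piFinset.2 fun i => Finset.mem_range.2 (by omega)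
    · exact fun t ht => funext fun i => Nat.sub_sub_self (hle t ht i)
    · exact fun t ht => funext fun i => Nat.sub_sub_self (hle t ht i)
    · intro t ht
      rw [integral_indicator_const _ (hγ.measurableSet_lastArrival_eq (hle t ht)), smul_eq_mul]
      congr 2
      ext ω
      simp only [Set.mem_ofPred_eq, funext_iff]
      refine forall_congr' fun i => ?_
      have := lastArrival_le γ k ω i
      have := hle t ht i
      omega
  · intro τ hτ
    rw [hγ.real_holdingTime_eq, if_neg, zero_mul]
    exact fun h => hτ (Fintype.mem_piFinset.2 fun i => Finset.mem_range.2 (Nat.lt_succ_of_le (h i)))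

/-- The expectation of a function of the holding times with geometric growth converges. -/
theorem tendsto_integral_holdingTime [Fintype ι] [IsProbabilityMeasure ν]
    (hγ : IsBernoulliArrivals ν rate γ) (hrate : ∀ i, 0 < rate i ∧ rate i ≤ 1)
    {f : (ι → ℕ) → ℝ} {B r : ℝ} (hr : 0 ≤ r) (hr1 : ∀ i, (1 - rate i) * r < 1)
    (hf : ∀ τ, |f τ| ≤ B * ∏ i, r ^ τ i) :
    ∃ l : ℝ, Tendsto (fun k => ∫ ω, f (fun i => k - lastArrival γ k ω i) ∂ν) atTop (𝓝 l) := by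
  classical
  refine ⟨∑' τ, (∏ i, rate i * (1 - rate i) ^ τ i) * f τ, ?_⟩
  simp only [hγ.integral_holdingTime_eq_tsum]
  have hq0 : ∀ i, 0 ≤ 1 - rate i := fun i => sub_nonneg.2 (hrate i).2
  refine tendsto_tsum_of_dominated_convergence
    (bound := fun τ => B * ∏ i, ((1 - rate i) * r) ^ τ i) ?_ ?_ ?_
  · exact (summable_prod_pow (fun i => mul_nonneg (hq0 i) hr) hr1).mul_left B
  · intro τ
    refine Tendsto.mul_const _ (tendsto_const_nhds.congr' ?_)
    -- Once `k` exceeds every `τ i`, truncation no longer affects the mass at `τ`.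
    filter_upwards [eventually_gt_atTop (∑ i, τ i)] with k hk
    have hlt : ∀ i, τ i < k := fun i =>
      (Finset.single_le_sum (f := τ) (fun _ _ => Nat.zero_le _) (Finset.mem_univ i)).trans_lt hk
    rw [hγ.real_holdingTime_eq, if_pos fun i => (hlt i).le]
    exact Finset.prod_congr rfl fun i _ => by rw [if_neg (hlt i).ne]
  · refine Eventually.of_forall fun k τ => ?_
    -- Dropping the arrival factors, which are at most `1`, also covers the atom at `τ i = k`.
    have h1 : ν.real {ω | (fun i => k - lastArrival γ k ω i) = τ} ≤ ∏ i, (1 - rate i) ^ τ i := by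
      rw [hγ.real_holdingTime_eq]
      split_ifs
      · refine Finset.prod_le_prod (fun i _ => ?_) fun i _ => ?_
        · split_ifs
          · simpa using pow_nonneg (hq0 i) _
          · exact mul_nonneg (hrate i).1.le (pow_nonneg (hq0 i) _)
        · refine mul_le_of_le_one_left (pow_nonneg (hq0 i) _) ?_
          split_ifs
          · exact le_rfl
          · exact (hrate i).2
      · exact Finset.prod_nonneg fun i _ => pow_nonneg (hq0 i) _
    rw [norm_mul, Real.norm_of_nonneg measureReal_nonneg, Real.norm_eq_abs]
    refine (mul_le_mul h1 (hf τ) (abs_nonneg _)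
      (Finset.prod_nonneg fun i _ => pow_nonneg (hq0 i) _)).trans_eq ?_
    simp only [mul_pow, Finset.prod_mul_distrib]
    ring

end IsBernoulliArrivals

end Arrivals

/-! ### The optimal value as a function of the holding times -/

namespace FusionSystem

variable {n : ℕ} {ι : Type*} [Fintype ι] {m d : ι → ℕ} (S : FusionSystem n ι m d)

/-- The optimal value of the fusion problem as a function of the holding times `τ`, if the local
errors have cross-covariances `Γ`. -/
noncomputable def fusionValue (Γ : (i j : ι) → Matrix (Fin (d i)) (Fin (d j)) ℝ) (τ : ι → ℕ) : ℝ :=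
  sInf ((fun U =>
    (combinedCov S.V (fun i j => S.holdCov i j (Γ i j) (τ i) (τ j)) U).trace) ''
      {U | fusionConstraint S.V U = 1})

end FusionSystem

namespace FusionInputs

variable {n : ℕ} {ι : Type*} [Fintype ι] {m d : ι → ℕ} {Ω : Type*}
  {D : FusionInputs n ι m d Ω} {S : FusionSystem n ι m d} [MeasurableSpace Ω] {μ : Measure Ω}

lemma fusedCov_eq_holdCov (hQ : S.Q.PosDef) (hR : ∀ i, (S.R i).PosDef)
    (hV : ∀ i, IsObservableBasis S.A (S.C i) (S.V i))
    (hnoise : D.IsWhiteNoise S μ) (hsteady : D.IsSteadyStart S μ)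
    {U : ι → Matrix (Fin n) (Fin n) ℝ} (hU : fusionConstraint S.V U = 1) {k : ℕ}
    {t : ι → ℕ} (ht : ∀ i, t i ≤ k) :
    D.fusedCov S μ U k t = combinedCov S.V
      (fun i j => S.holdCov i j (secondMoment μ (D.localErr S i 0) (D.localErr S j 0))
        (k - t i) (k - t j)) U := by
  rw [fusedCov_eq hV hnoise hsteady hU ht]
  congr 1
  funext i j
  exact secondMoment_remoteErr hQ hR hV hnoise hsteady i j (ht i) (ht j)

lemma IsOptimalFusion.trace_eq (hQ : S.Q.PosDef) (hR : ∀ i, (S.R i).PosDef)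
    (hV : ∀ i, IsObservableBasis S.A (S.C i) (S.V i))
    (hnoise : D.IsWhiteNoise S μ) (hsteady : D.IsSteadyStart S μ) {k : ℕ}
    {t : ι → ℕ} (ht : ∀ i, t i ≤ k) {W : ι → Matrix (Fin n) (Fin n) ℝ}
    (hW : D.IsOptimalFusion S μ k t W) :
    (D.fusedCov S μ W k t).trace =
      S.fusionValue (fun i j => secondMoment μ (D.localErr S i 0) (D.localErr S j 0))
        (fun i => k - t i) := by
  rw [fusedCov_eq_holdCov hQ hR hV hnoise hsteady hW.2 ht]
  symm
  refine IsLeast.csInf_eq ⟨⟨W, hW.2, rfl⟩, ?_⟩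
  rintro _ ⟨U, hU, rfl⟩
  have h := isMinOn_iff.1 hW.1 U hU
  rwa [fusedCov_eq_holdCov hQ hR hV hnoise hsteady hU ht,
    fusedCov_eq_holdCov hQ hR hV hnoise hsteady hW.2 ht] at h

/-- The optimal value of the fusion problem grows at most geometrically with the holding times. -/
lemma exists_abs_fusionValue_le (hQ : S.Q.PosDef) (hR : ∀ i, (S.R i).PosDef)
    (hV : ∀ i, IsObservableBasis S.A (S.C i) (S.V i)) (hobs : IsObservablePair S.A S.stackedC)
    (hnoise : D.IsWhiteNoise S μ) (hsteady : D.IsSteadyStart S μ) {b : ℝ}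
    (hb : specRad S.A < b) (hb1 : 1 < b) :
    ∃ B : ℝ, ∀ τ, |S.fusionValue
      (fun i j => secondMoment μ (D.localErr S i 0) (D.localErr S j 0)) τ| ≤
        B * ∏ i, (b ^ 2) ^ τ i := by
  obtain ⟨W₀, hW₀⟩ := S.exists_feasible hV hobs
  have hf : fusionConstraint S.V (fun _ => W₀) = 1 := hW₀
  obtain ⟨κ, hκ0, hκ⟩ := abs_trace_combinedCov_le S.V fun _ => W₀
  choose c hc0 hc using fun i => S.exists_abs_holdCov_diag_le i (hV i) hb hb1
    (secondMoment μ (D.localErr S i 0) (D.localErr S i 0))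
  have hr1 : 1 ≤ b ^ 2 := by nlinarith
  refine ⟨κ * (2 * ∑ i, c i), fun τ => ?_⟩
  -- Any time at least every `τ i` would do: it realizes `τ` by actual packets, so the value is a
  -- genuine error variance.
  set k := ∑ i, τ i with hk
  set t : ι → ℕ := fun i => k - τ i with ht
  have hτk : ∀ i, τ i ≤ k := fun i =>
    Finset.single_le_sum (f := τ) (fun _ _ => Nat.zero_le _) (Finset.mem_univ i)
  have htk : ∀ i, t i ≤ k := fun i => Nat.sub_le _ _
  have hτ : (fun i => k - t i) = τ := funext fun i => Nat.sub_sub_self (hτk i)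
  obtain ⟨W, hW⟩ := exists_isOptimalFusion hV hobs hnoise hsteady htk
  have hval := hW.trace_eq hQ hR hV hnoise hsteady htk
  rw [hτ] at hval
  have hnonneg : 0 ≤ (D.fusedCov S μ W k t).trace :=
    Finset.sum_nonneg fun a _ => secondMoment_self_nonneg _ a
  rw [← hval, abs_of_nonneg hnonneg]
  refine (isMinOn_iff.1 hW.1 _ hW₀).trans ?_
  rw [fusedCov_eq hV hnoise hsteady hf htk]
  refine (le_abs_self _).trans ((hκ _ ((2 * ∑ i, c i) * ∏ i, (b ^ 2) ^ τ i) ?_).trans_eq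
    (mul_assoc _ _ _).symm)
  have hdiag : ∀ i a, secondMoment μ (D.remoteErr S i k (t i)) (D.remoteErr S i k (t i)) a a ≤
      (∑ i, c i) * ∏ i, (b ^ 2) ^ τ i := by
    intro i a
    rw [secondMoment_remoteErr hQ hR hV hnoise hsteady i i (htk i) (htk i),
      show k - t i = τ i from congrFun hτ i]
    refine (le_abs_self _).trans ((hc i (τ i) a a).trans ?_)
    refine mul_le_mul (Finset.single_le_sum (fun i _ => hc0 i) (Finset.mem_univ i)) ?_
      (by positivity) (Finset.sum_nonneg fun i _ => hc0 i)
    -- The product is `(b ^ 2) ^ k`, which dominates each single power because `b ^ 2 ≥ 1`.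
    rw [Finset.prod_pow_eq_pow_sum]
    exact pow_le_pow_right₀ hr1 (hτk i)
  intro i j x y
  refine (abs_secondMoment_le (isSquareIntegrable_remoteErr hV hnoise hsteady i (htk i))
    (isSquareIntegrable_remoteErr hV hnoise hsteady j (htk j)) x y).trans ?_
  linarith [hdiag i x, hdiag j y]

end FusionInputs

/-! ### The proposition -/

theorem mainTheorem2 {n : ℕ} {ι : Type*} [Fintype ι] [Nonempty ι] {m d : ι → ℕ}
    (S : FusionSystem n ι m d)
    (hQ : S.Q.PosDef) (hR : ∀ i, (S.R i).PosDef)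
    (hV : ∀ i, IsObservableBasis S.A (S.C i) (S.V i))
    (hobs : IsObservablePair S.A S.stackedC)
    (rate : ι → ℝ) (hrate : ∀ i, 0 < rate i ∧ rate i ≤ 1)
    (hfeas : (1 - ⨅ i, rate i) * specRad S.A ^ 2 < 1)
    {Ω : Type*} [MeasurableSpace Ω] (μ : Measure Ω) [IsProbabilityMeasure μ]
    (D : FusionInputs n ι m d Ω)
    (hnoise : D.IsWhiteNoise S μ) (hsteady : D.IsSteadyStart S μ)
    {Ω' : Type*} [MeasurableSpace Ω'] (ν : Measure Ω') [IsProbabilityMeasure ν]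
    (γ : ι → ℕ → Ω' → Bool) (hγ : IsBernoulliArrivals ν rate γ) :
    (∀ k ω, ∃ W, D.IsOptimalFusion S μ k (lastArrival γ k ω) W) ∧
    ∀ Wopt : ℕ → Ω' → ι → Matrix (Fin n) (Fin n) ℝ,
      (∀ k ω, D.IsOptimalFusion S μ k (lastArrival γ k ω) (Wopt k ω)) →
      (∀ k a b, Integrable
        (fun ω => D.fusedCov S μ (Wopt k ω) k (lastArrival γ k ω) a b) ν) ∧
      ∃ L : ℝ, Tendsto
        (fun k => (Matrix.of fun a b : Fin n =>
          ∫ ω, D.fusedCov S μ (Wopt k ω) k (lastArrival γ k ω) a b ∂ν).trace)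
        atTop (𝓝 L) := by
  refine ⟨fun k ω => FusionInputs.exists_isOptimalFusion hV hobs hnoise hsteady
    (lastArrival_le γ k ω), fun Wopt hW => ?_⟩
  have hint : ∀ k a b, Integrable
      (fun ω => D.fusedCov S μ (Wopt k ω) k (lastArrival γ k ω) a b) ν := by
    intro k a b
    -- `Wopt` may depend on `ω` non-measurably. Fixing one minimizer per arrival pattern leaves the
    -- covariance unchanged and makes it a function of the last arrival times.
    choose! W hWk using fun t : ι → ℕ => fun ht : ∀ i, t i ≤ k =>
      FusionInputs.exists_isOptimalFusion hV hobs hnoise hsteady ht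
    have h : (fun ω => D.fusedCov S μ (Wopt k ω) k (lastArrival γ k ω) a b) =
        fun ω => (fun t => D.fusedCov S μ (W t) k t a b) (lastArrival γ k ω) := by
      funext ω
      have hle := lastArrival_le γ k ω
      rw [(hW k ω).fusedCov_eq hV hnoise hsteady hle (hWk _ hle)]
    rw [h]
    exact hγ.integrable_comp_lastArrival k fun t => D.fusedCov S μ (W t) k t a b
  refine ⟨hint, ?_⟩
  -- The infimum over the finite nonempty set of sensors is attained, hence positive.
  obtain ⟨i₀, hi₀⟩ := exists_eq_ciInf_of_finite (f := rate)
  obtain ⟨b, hb, hb1, hb2⟩ := exists_growth_rate (hi₀ ▸ (hrate i₀).1) hfeas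
  obtain ⟨B, hB⟩ := FusionInputs.exists_abs_fusionValue_le hQ hR hV hobs hnoise hsteady hb hb1
  have hr1 : ∀ i, (1 - rate i) * b ^ 2 < 1 := fun i =>
    (mul_le_mul_of_nonneg_right (sub_le_sub_left (ciInf_le (Set.finite_range rate).bddBelow i) 1)
      (sq_nonneg b)).trans_lt hb2
  obtain ⟨l, hl⟩ := hγ.tendsto_integral_holdingTime hrate (sq_nonneg b) hr1 hB
  refine ⟨l, hl.congr fun k => ?_⟩
  simp only [Matrix.trace, Matrix.diag_apply, Matrix.of_apply]
  rw [← integral_finsetSum _ fun a _ => hint k a a]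
  refine integral_congr_ae (Eventually.of_forall fun ω => ?_)
  exact ((hW k ω).trace_eq hQ hR hV hnoise hsteady (lastArrival_le γ k ω)).symm
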